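/- Let $\mathbb T=\mathbb R/2\pi\mathbb Z$ and, for $\varepsilon>0$, let $\chi_\varepsilon(x)=\frac{1+\tanh(\varepsilon x)}{2}$. For every $c_1>0$ there exist $\delta>0$ and $\varepsilon_0>0$, depending only on $c_1$, such that the following holds. Let $u\in C(\mathbb R;H^8(\mathbb R_x\times\mathbb T_y))$ be a real-valued solution, in the sense of distributions on $\mathbb R_t\times\mathbb R_x\times\mathbb T_y$, of the KP-II equation $$\partial_x\big(\partial_t u+\partial_x^3u+3\partial_x(u^2)\big)+3\partial_y^2u=0,$$ with $\|u(0,\cdot)\|_{L^2(\mathbb R\times\mathbb T)}\le\delta$, and let $0<\varepsilon<\varepsilon_0$. Then, for every $x_0\in\mathbb R$, the function $$t\mapsto I(t)=\int_{\mathbb R_x\times\mathbb T_y}u^2(t,x,y)\,\chi_\varepsilon(x+x_0-c_1t)\,dx\,dy$$ is nonincreasing on $\mathbb R$; in particular $\frac{dI}{dt}$ exists for almost every $t$, and $\frac{dI}{dt}(t)\le 0$ at every $t$ where it exists. Moreover, $$\lim_{t\to\infty}\int_{\mathbb R_x\times\mathbb T_y}u^2(t,x,y)\,\chi_\varepsilon(x-c_1t)\,dx\,dy=0.$$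 -/

import Mathlib

open MeasureTheory Filter Topology
open scoped ContDiff

noncomputable section

namespace KP

/-- The torus `𝕋 = ℝ / 2πℤ`; its `volume` is the Lebesgue measure, of total mass `2π`. -/
abbrev Torus : Type := AddCircle (2 * Real.pi)

instance instFactTwoPi : Fact (0 < 2 * Real.pi) := ⟨Real.two_pi_pos⟩

/-- The cylinder `ℝ_x × 𝕋_y`, with the product Lebesgue measure as `volume`. -/
abbrev Cyl : Type := ℝ × Torus

/-- The real Hilbert space `L²(ℝ_x × 𝕋_y)`. -/
abbrev L2 : Type := Lp ℝ 2 (volume : Measure Cyl)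

/-- `∂_x` of a function on the cylinder (used on smooth test functions only). -/
def dx (f : Cyl → ℝ) : Cyl → ℝ :=
  fun z => deriv (fun s : ℝ => f (z.1 + s, z.2)) 0

/-- `∂_y` of a function on the cylinder (used on smooth test functions only). -/
def dy (f : Cyl → ℝ) : Cyl → ℝ :=
  fun z => deriv (fun s : ℝ => f (z.1, z.2 + (s : Torus))) 0

/-- `∂_t` of a time-dependent function on the cylinder (used on smooth test functions only). -/
def dt (f : ℝ → Cyl → ℝ) : ℝ → Cyl → ℝ :=
  fun t z => deriv (fun s : ℝ => f s z) t

/-- Test functions on the cylinder: `C_c^∞(ℝ × 𝕋)`. Smoothness is that of the lift to `ℝ²`,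
which is `2π`-periodic in `y`. -/
structure IsTest (φ : Cyl → ℝ) : Prop where
  smooth : ContDiff ℝ ∞ (fun p : ℝ × ℝ => φ (p.1, (p.2 : Torus)))
  compact_support : HasCompactSupport φ

/-- Space-time test functions: `C_c^∞(ℝ_t × ℝ_x × 𝕋_y)`. -/
structure IsSpaceTimeTest (φ : ℝ → Cyl → ℝ) : Prop where
  smooth : ContDiff ℝ ∞ (fun p : ℝ × ℝ × ℝ => φ p.1 (p.2.1, (p.2.2 : Torus)))
  compact_support : HasCompactSupport (fun p : ℝ × Cyl => φ p.1 p.2)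

/-- `g = ∂_x^a ∂_y^b f` in the weak sense. -/
def HasWeakDeriv (a b : ℕ) (f g : L2) : Prop :=
  ∀ φ : Cyl → ℝ, IsTest φ →
    ∫ z, f z * (dx^[a] (dy^[b] φ)) z = (-1) ^ (a + b) * ∫ z, g z * φ z

/-- `u ∈ C(ℝ; H^k(ℝ × 𝕋))`: for every `a + b ≤ k` the weak derivative `∂_x^a ∂_y^b u(t)` exists
in `L²` and is continuous in `t` for the `L²` norm, i.e. `t ↦ u(t)` is continuous for the norm
`(∑_{a+b≤k} ‖∂_x^a ∂_y^b u‖²_{L²})^{1/2}` of `H^k`. -/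
def ContinuousInSobolev (k : ℕ) (u : ℝ → L2) : Prop :=
  ∀ a b : ℕ, a + b ≤ k →
    ∃ v : ℝ → L2, Continuous v ∧ ∀ t, HasWeakDeriv a b (u t) (v t)

/-- `u` solves the KP-II equation
`∂_x (∂_t u + ∂_x³ u + 3 ∂_x (u²)) + 3 ∂_y² u = 0`
in the sense of distributions on `ℝ_t × ℝ_x × 𝕋_y`. -/
def SolvesKPII (u : ℝ → L2) : Prop :=
  ∀ φ : ℝ → Cyl → ℝ, IsSpaceTimeTest φ →
    ∫ t, ∫ z,
      (u t z * dt (fun s => dx (φ s)) t z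
        + u t z * (dx^[4] (φ t)) z
        + 3 * (u t z) ^ 2 * (dx^[2] (φ t)) z
        + 3 * u t z * (dy^[2] (φ t)) z) = 0

/-- The weight `χ_ε(x) = (1 + tanh(ε x)) / 2`. -/
def chi (ε x : ℝ) : ℝ := (1 + Real.tanh (ε * x)) / 2

/-- The weighted mass `∫_{ℝ × 𝕋} u²(x, y) χ_ε(x + a) dx dy`. -/
def weightedMass (ε a : ℝ) (u : L2) : ℝ :=
  ∫ z : Cyl, (u z) ^ 2 * chi ε (z.1 + a)

end KP

end

/-! Formally, multiplying the equation by `2uX` with `X = χ(x + x₀ - ct)` and integrating by parts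
gives the virial identity d/dt ∫ u²X = ∫ [-X'(c u² + 3 u_x² + 3 v²) + X''' u² + 4 X' u³], where v_x
= u_y. For `χ = χ_ε` one has |χ'''| ≤ 4ε² χ', so a small `ε` lets `c u²` absorb the third
derivative. The cubic term is absorbed by means of `abs_integral_cube_le`, |∫ u³ψ| ≤ 3 ‖u‖ ∫ ψ (u² +
u_x² + v²), once `‖u‖` is small. Smallness at time 0 persists because the same identity with a
constant weight conserves the `L²` norm (`norm_eq_norm_zero`).

The antiderivative `v` of `u_y` need not be available for `u` itself, so the argument runs on
mollifications. For a test function `K` put w = ∂_xK ∗ u, v = ∂_yK ∗ u, q = ∂_xK ∗ u². Then v_x =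
w_y holds automatically, and testing the equation with θ(t)K(z - ·) gives w_t = -(w_xxx + 3q_x +
3v_y) classically in time. The kernel ∂_xK has integral zero, yet convolution with it can
approximate the identity on `L²`: take ∂_xK = g - G with `g` concentrating at the origin and `G`
spreading out, so that G ∗ f tends to 0 in `L²` (`exists_kernels`).

The virial identity for `w` (`virial_identity`) has one extra term, 6∫ (wX)_x (q - w²). It tends to
0 because `u` is bounded, by a Sobolev inequality. Integrating in time and passing to the limit
gives monotonicity (`antitone_of_virialMain_nonpos`).

For the decay, monotonicity is used at speed c₁/2 with x₀ = -c₁t/2. This bounds the mass at time `t`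
near x > c₁t by the mass of `u(0)` seen by a weight centred at c₁t/2, which tends to 0. -/

noncomputable section

namespace KP

/-! ### Classical partial derivatives and test functions on the cylinder. -/

/-- `F'` is the classical partial derivative of `F` in the first variable, everywhere. -/
def HasDx (F F' : Cyl → ℝ) : Prop :=
  ∀ (x : ℝ) (y : Torus), HasDerivAt (fun s : ℝ => F (s, y)) (F' (x, y)) x

/-- `F'` is the classical partial derivative of `F` in the second variable, everywhere. -/
def HasDy (F F' : Cyl → ℝ) : Prop :=
  ∀ x y : ℝ, HasDerivAt (fun s : ℝ => F (x, (s : Torus))) (F' (x, (y : Torus))) y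

theorem exists_lift (y : Torus) : ∃ s : ℝ, (s : Torus) = y := QuotientAddGroup.mk_surjective y

theorem HasDx.dx_eq {F F' : Cyl → ℝ} (h : HasDx F F') : dx F = F' := by
  funext z
  have h1 := h z.1 z.2
  have h2 : HasDerivAt (fun s : ℝ => F (z.1 + s, z.2)) (F' z) 0 := by
    have := HasDerivAt.comp_const_add (f := fun s : ℝ => F (s, z.2)) z.1 0 (by simpa using h1)
    exact this
  exact h2.deriv

theorem isOpenQuotientMap_lift :
    IsOpenQuotientMap (fun p : ℝ × ℝ => ((p.1, (p.2 : Torus)) : Cyl)) := by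
  have h1 : IsOpenQuotientMap (fun y : ℝ => (y : Torus)) := QuotientAddGroup.isOpenQuotientMap_mk
  exact (IsOpenQuotientMap.id (X := ℝ)).prodMap h1

theorem IsTest.continuous {φ : Cyl → ℝ} (h : IsTest φ) : Continuous φ := by
  have := isOpenQuotientMap_lift.isQuotientMap.continuous_iff (g := φ)
  exact this.2 h.smooth.continuous

theorem IsTest.dx_lift {φ : Cyl → ℝ} (h : IsTest φ) (p : ℝ × ℝ) :
    HasDerivAt (fun s : ℝ => φ (s, (p.2 : Torus)))
      (fderiv ℝ (fun p : ℝ × ℝ => φ (p.1, (p.2 : Torus))) p (1, 0)) p.1 := by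
  have h1 := (h.smooth.differentiable (by simp) p).hasFDerivAt
  have h2 : HasDerivAt (fun s : ℝ => (s, p.2)) ((1 : ℝ), (0 : ℝ)) p.1 :=
    (hasDerivAt_id p.1).prodMk (hasDerivAt_const _ _)
  exact HasFDerivAt.comp_hasDerivAt (x := p.1) (f := fun s : ℝ => (s, p.2)) h1 h2

theorem IsTest.dy_lift {φ : Cyl → ℝ} (h : IsTest φ) (p : ℝ × ℝ) :
    HasDerivAt (fun s : ℝ => φ (p.1, (s : Torus)))
      (fderiv ℝ (fun p : ℝ × ℝ => φ (p.1, (p.2 : Torus))) p (0, 1)) p.2 := by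
  have h1 := (h.smooth.differentiable (by simp) p).hasFDerivAt
  have h2 : HasDerivAt (fun s : ℝ => (p.1, s)) ((0 : ℝ), (1 : ℝ)) p.2 :=
    (hasDerivAt_const _ _).prodMk (hasDerivAt_id p.2)
  exact HasFDerivAt.comp_hasDerivAt (x := p.2) (f := fun s : ℝ => (p.1, s)) h1 h2

theorem IsTest.dx_apply {φ : Cyl → ℝ} (h : IsTest φ) (p : ℝ × ℝ) :
    dx φ (p.1, (p.2 : Torus))
      = fderiv ℝ (fun p : ℝ × ℝ => φ (p.1, (p.2 : Torus))) p (1, 0) := by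
  have h1 := h.dx_lift p
  have := HasDerivAt.comp_const_add (f := fun s : ℝ => φ (s, (p.2 : Torus))) p.1 0
    (by simpa using h1)
  exact this.deriv

theorem IsTest.dy_apply {φ : Cyl → ℝ} (h : IsTest φ) (p : ℝ × ℝ) :
    dy φ (p.1, (p.2 : Torus))
      = fderiv ℝ (fun p : ℝ × ℝ => φ (p.1, (p.2 : Torus))) p (0, 1) := by
  have h1 := h.dy_lift p
  have h2 := HasDerivAt.comp_const_add (f := fun s : ℝ => φ (p.1, (s : Torus))) p.2 0
    (by simpa using h1)
  have h3 : HasDerivAt (fun s : ℝ => φ (p.1, (p.2 : Torus) + (s : Torus)))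
      (fderiv ℝ (fun p : ℝ × ℝ => φ (p.1, (p.2 : Torus))) p (0, 1)) 0 := by
    simpa using h2
  exact h3.deriv

theorem IsTest.hasDx {φ : Cyl → ℝ} (h : IsTest φ) : HasDx φ (dx φ) := by
  intro x y
  obtain ⟨r, rfl⟩ := exists_lift y
  have := h.dx_lift (x, r)
  rwa [← h.dx_apply (x, r)] at this

theorem IsTest.hasDy {φ : Cyl → ℝ} (h : IsTest φ) : HasDy φ (dy φ) := by
  intro x r
  have := h.dy_lift (x, r)
  rwa [← h.dy_apply (x, r)] at this

theorem IsTest.dx {φ : Cyl → ℝ} (h : IsTest φ) : IsTest (dx φ) where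
  smooth := by
    have : (fun p : ℝ × ℝ => KP.dx φ (p.1, (p.2 : Torus))) =
        fun p => fderiv ℝ (fun p : ℝ × ℝ => φ (p.1, (p.2 : Torus))) p (1, 0) := by
      funext p; exact h.dx_apply p
    rw [this]
    exact (h.smooth.fderiv_right (m := ∞) (by simp)).clm_apply contDiff_const
  compact_support := by
    refine HasCompactSupport.of_support_subset_isCompact h.compact_support.isCompact ?_
    intro z hz
    by_contra hn
    apply hz
    have h1 : ∀ᶠ z' in 𝓝 z, φ z' = 0 := by
      rw [notMem_tsupport_iff_eventuallyEq] at hn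
      exact hn
    have h2 : Tendsto (fun s : ℝ => ((z.1 + s, z.2) : Cyl)) (𝓝 0) (𝓝 z) := by
      have : Continuous (fun s : ℝ => ((z.1 + s, z.2) : Cyl)) := by fun_prop
      simpa using this.tendsto 0
    have h3 : (fun s : ℝ => φ (z.1 + s, z.2)) =ᶠ[𝓝 0] fun _ => 0 := h2.eventually h1
    simp only [KP.dx, h3.deriv_eq, deriv_const]

theorem IsTest.dy {φ : Cyl → ℝ} (h : IsTest φ) : IsTest (dy φ) where
  smooth := by
    have : (fun p : ℝ × ℝ => KP.dy φ (p.1, (p.2 : Torus))) =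
        fun p => fderiv ℝ (fun p : ℝ × ℝ => φ (p.1, (p.2 : Torus))) p (0, 1) := by
      funext p; exact h.dy_apply p
    rw [this]
    exact (h.smooth.fderiv_right (m := ∞) (by simp)).clm_apply contDiff_const
  compact_support := by
    refine HasCompactSupport.of_support_subset_isCompact h.compact_support.isCompact ?_
    intro z hz
    by_contra hn
    apply hz
    have h1 : ∀ᶠ z' in 𝓝 z, φ z' = 0 := by
      rw [notMem_tsupport_iff_eventuallyEq] at hn
      exact hn
    have h2 : Tendsto (fun s : ℝ => ((z.1, z.2 + (s : Torus)) : Cyl)) (𝓝 0) (𝓝 z) := by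
      have h0 : Continuous (fun s : ℝ => (s : Torus)) := AddCircle.continuous_mk' _
      have : Continuous (fun s : ℝ => ((z.1, z.2 + (s : Torus)) : Cyl)) := by fun_prop
      simpa using this.tendsto 0
    have h3 : (fun s : ℝ => φ (z.1, z.2 + (s : Torus))) =ᶠ[𝓝 0] fun _ => 0 := h2.eventually h1
    simp only [KP.dy, h3.deriv_eq, deriv_const]

theorem IsTest.dx_dy_comm {φ : Cyl → ℝ} (h : IsTest φ) : KP.dx (KP.dy φ) = KP.dy (KP.dx φ) := by
  funext z
  obtain ⟨x, y⟩ := z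
  obtain ⟨r, rfl⟩ := exists_lift y
  have e1 : (fun p : ℝ × ℝ => KP.dy φ (p.1, (p.2 : Torus))) =
      fun p => fderiv ℝ (fun p : ℝ × ℝ => φ (p.1, (p.2 : Torus))) p (0, 1) := by
    funext p; exact h.dy_apply p
  have e2 : (fun p : ℝ × ℝ => KP.dx φ (p.1, (p.2 : Torus))) =
      fun p => fderiv ℝ (fun p : ℝ × ℝ => φ (p.1, (p.2 : Torus))) p (1, 0) := by
    funext p; exact h.dx_apply p
  rw [h.dy.dx_apply (x, r), h.dx.dy_apply (x, r), e1, e2]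
  have hd : DifferentiableAt ℝ (fderiv ℝ (fun p : ℝ × ℝ => φ (p.1, (p.2 : Torus)))) (x, r) :=
    (h.smooth.fderiv_right (m := ∞) (by simp)).differentiable (by simp) _
  have f1 : ∀ v : ℝ × ℝ, fderiv ℝ (fun p => fderiv ℝ
      (fun p : ℝ × ℝ => φ (p.1, (p.2 : Torus))) p v) (x, r)
      = (fderiv ℝ (fderiv ℝ (fun p : ℝ × ℝ => φ (p.1, (p.2 : Torus)))) (x, r)).flip v := by
    intro v
    exact (hd.hasFDerivAt.clm_apply (hasFDerivAt_const v _)).fderiv.trans (by simp)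
  rw [f1, f1]
  have hs : IsSymmSndFDerivAt ℝ (fun p : ℝ × ℝ => φ (p.1, (p.2 : Torus))) (x, r) := by
    apply ContDiffAt.isSymmSndFDerivAt (n := ∞) h.smooth.contDiffAt
    simp only [minSmoothness_of_isRCLikeNormedField]
    exact WithTop.coe_le_coe.2 (le_top : (2 : ℕ∞) ≤ ⊤)
  exact hs _ _

/-- Reflected translates used as test functions turn distributional identities into pointwise
identities between convolutions. -/
theorem IsTest.reflect {κ : Cyl → ℝ} (h : IsTest κ) (z : Cyl) : IsTest (fun z' => κ (z - z')) where
  smooth := by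
    obtain ⟨x, y⟩ := z
    obtain ⟨r, rfl⟩ := exists_lift y
    have : (fun p : ℝ × ℝ => κ ((x, (r : Torus)) - (p.1, (p.2 : Torus)))) =
        (fun p : ℝ × ℝ => κ (p.1, (p.2 : Torus))) ∘ (fun p : ℝ × ℝ => (x - p.1, r - p.2)) := by
      funext p; simp
    rw [this]
    exact h.smooth.comp (by fun_prop)
  compact_support := h.compact_support.comp_homeomorph (Homeomorph.subLeft z)

theorem dx_reflect (κ : Cyl → ℝ) (z : Cyl) :
    dx (fun z' => κ (z - z')) = fun z' => -dx κ (z - z') := by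
  funext z'
  have : (fun s : ℝ => κ (z - (z'.1 + s, z'.2))) =
      fun s : ℝ => (fun s => κ ((z - z').1 + s, (z - z').2)) (-s) := by
    funext s
    congr 1
    ext <;> simp; ring
  simp only [dx, this]
  rw [deriv_comp_neg (f := fun s => κ ((z - z').1 + s, (z - z').2))]
  simp

theorem dy_reflect (κ : Cyl → ℝ) (z : Cyl) :
    dy (fun z' => κ (z - z')) = fun z' => -dy κ (z - z') := by
  funext z'
  have : (fun s : ℝ => κ (z - (z'.1, z'.2 + (s : Torus)))) =
      fun s : ℝ => (fun s : ℝ => κ ((z - z').1, (z - z').2 + (s : Torus))) (-s) := by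
    funext s
    congr 1
    ext <;> simp
    abel
  simp only [dy, this]
  rw [deriv_comp_neg (f := fun s : ℝ => κ ((z - z').1, (z - z').2 + (s : Torus)))]
  simp

theorem dx_const_mul (c : ℝ) (f : Cyl → ℝ) : dx (fun z => c * f z) = fun z => c * dx f z := by
  funext z
  simp only [dx]
  exact deriv_const_mul_field c

theorem dy_const_mul (c : ℝ) (f : Cyl → ℝ) : dy (fun z => c * f z) = fun z => c * dy f z := by
  funext z
  simp only [dy]
  exact deriv_const_mul_field c

theorem dx_neg (f : Cyl → ℝ) : dx (fun z => -f z) = fun z => -dx f z := by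
  simpa using dx_const_mul (-1) f

theorem IsTest.exists_bound {φ : Cyl → ℝ} (h : IsTest φ) : ∃ C, ∀ z, |φ z| ≤ C :=
  h.compact_support.exists_bound_of_continuous h.continuous

theorem IsTest.integrable {φ : Cyl → ℝ} (h : IsTest φ) : Integrable φ :=
  h.continuous.integrable_of_hasCompactSupport h.compact_support

theorem IsTest.memLp {φ : Cyl → ℝ} (h : IsTest φ) (p : ENNReal) : MemLp φ p :=
  h.continuous.memLp_of_hasCompactSupport h.compact_support


instance instHaarCyl : (volume : Measure Cyl).IsAddHaarMeasure :=
  inferInstanceAs ((volume : Measure ℝ).prod (volume : Measure Torus)).IsAddHaarMeasure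

instance instNegInvariantCyl : (volume : Measure Cyl).IsNegInvariant := inferInstance

/-! ### Hölder-type inequalities for the `L²` norm of genuine functions. -/

section L2norm

/-- The `L²` norm of a function on the cylinder. -/
def l2 (f : Cyl → ℝ) : ℝ := (eLpNorm f 2 volume).toReal

theorem l2_nonneg (f : Cyl → ℝ) : 0 ≤ l2 f := ENNReal.toReal_nonneg

theorem l2_eq_norm (u : L2) : l2 u = ‖u‖ := (Lp.norm_def u).symm

theorem l2_toLp {f : Cyl → ℝ} (hf : MemLp f 2) : ‖hf.toLp f‖ = l2 f := Lp.norm_toLp f hf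

theorem l2_congr {f g : Cyl → ℝ} (h : f =ᵐ[volume] g) : l2 f = l2 g := by
  rw [l2, l2, eLpNorm_congr_ae h]

theorem l2_sq {f : Cyl → ℝ} (hf : MemLp f 2) : l2 f ^ 2 = ∫ z, f z ^ 2 := by
  rw [← l2_toLp hf, ← real_inner_self_eq_norm_sq, L2.inner_def]
  refine integral_congr_ae ?_
  filter_upwards [hf.coeFn_toLp] with z hz
  rw [hz]
  simp [sq]

theorem abs_integral_mul_le {f g : Cyl → ℝ} (hf : MemLp f 2) (hg : MemLp g 2) :
    |∫ z, f z * g z| ≤ l2 f * l2 g := by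
  rw [← l2_toLp hf, ← l2_toLp hg]
  refine le_trans (le_of_eq ?_) (abs_real_inner_le_norm _ _)
  rw [L2.inner_def]
  congr 1
  refine integral_congr_ae ?_
  filter_upwards [hf.coeFn_toLp, hg.coeFn_toLp] with z hz hz'
  rw [hz, hz']
  simp [mul_comm]

theorem l2_abs (f : Cyl → ℝ) : l2 (fun z => |f z|) = l2 f := by
  rw [l2, l2]
  congr 1
  exact eLpNorm_norm f

theorem integral_abs_mul_le {f g : Cyl → ℝ} (hf : MemLp f 2) (hg : MemLp g 2) :
    ∫ z, |f z * g z| ≤ l2 f * l2 g := by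
  have := abs_integral_mul_le hf.norm hg.norm
  simp only [Real.norm_eq_abs, l2_abs] at this
  simp only [abs_mul]
  exact (le_abs_self _).trans this

theorem integrable_mul {f g : Cyl → ℝ} (hf : MemLp f 2) (hg : MemLp g 2) :
    Integrable (fun z => f z * g z) := hf.integrable_mul hg

theorem integrable_sq {f : Cyl → ℝ} (hf : MemLp f 2) : Integrable (fun z => f z ^ 2) :=
  hf.integrable_sq

theorem l2_add_le {f g : Cyl → ℝ} (hf : MemLp f 2) (hg : MemLp g 2) :
    l2 (fun z => f z + g z) ≤ l2 f + l2 g := by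
  rw [l2, l2, l2, ← ENNReal.toReal_add hf.eLpNorm_ne_top hg.eLpNorm_ne_top]
  exact ENNReal.toReal_mono (ENNReal.add_ne_top.2 ⟨hf.eLpNorm_ne_top, hg.eLpNorm_ne_top⟩)
    (eLpNorm_add_le hf.1 hg.1 (by norm_num))

theorem l2_sub_le {f g : Cyl → ℝ} (hf : MemLp f 2) (hg : MemLp g 2) :
    l2 (fun z => f z - g z) ≤ l2 f + l2 g := by
  rw [l2, l2, l2, ← ENNReal.toReal_add hf.eLpNorm_ne_top hg.eLpNorm_ne_top]
  exact ENNReal.toReal_mono (ENNReal.add_ne_top.2 ⟨hf.eLpNorm_ne_top, hg.eLpNorm_ne_top⟩)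
    (eLpNorm_sub_le hf.1 hg.1 (by norm_num))

theorem memLp_bdd_mul {f g : Cyl → ℝ} {C : ℝ} (hf : AEStronglyMeasurable f volume)
    (hC : ∀ᵐ z, |f z| ≤ C) (hg : MemLp g 2) : MemLp (fun z => f z * g z) 2 := by
  refine hg.of_le_mul (c := C) (hf.mul hg.1) ?_
  filter_upwards [hC] with z hz
  rw [norm_mul]
  exact mul_le_mul_of_nonneg_right hz (norm_nonneg _)

theorem l2_bdd_mul_le {f g : Cyl → ℝ} {C : ℝ} (hC0 : 0 ≤ C) (hC : ∀ᵐ z, |f z| ≤ C)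
    (hg : MemLp g 2) : l2 (fun z => f z * g z) ≤ C * l2 g := by
  have h := eLpNorm_le_mul_eLpNorm_of_ae_le_mul (μ := volume) (f := fun z => f z * g z) (g := g)
    (c := C) (by filter_upwards [hC] with z hz
                 rw [norm_mul]
                 exact mul_le_mul_of_nonneg_right hz (norm_nonneg _)) 2
  have h2 := ENNReal.toReal_mono (ENNReal.mul_ne_top ENNReal.ofReal_ne_top hg.eLpNorm_ne_top) h
  rwa [ENNReal.toReal_mul, ENNReal.toReal_ofReal hC0] at h2

theorem l2_le_of_integral_sq_le {f : Cyl → ℝ} (hf : MemLp f 2) {C : ℝ} (hC : 0 ≤ C)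
    (h : ∫ z, f z ^ 2 ≤ C ^ 2) : l2 f ≤ C := by
  rw [← l2_sq hf] at h
  exact (sq_le_sq₀ (l2_nonneg f) hC).1 h

end L2norm

/-! ### Convolution with test functions: Young's inequality and differentiation. -/

section Conv

/-- The convolution `κ ∗ f` on the cylinder. -/
def conv (κ f : Cyl → ℝ) : Cyl → ℝ := fun z => ∫ z', f z' * κ (z - z')

theorem conv_eq_convolution (κ f : Cyl → ℝ) :
    conv κ f = convolution f κ (ContinuousLinearMap.mul ℝ ℝ) volume := by
  funext z
  simp [conv, convolution_def]

theorem conv_continuous {κ f : Cyl → ℝ} (hκ : Continuous κ) (hc : HasCompactSupport κ)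
    (hf : LocallyIntegrable f) : Continuous (conv κ f) := by
  rw [conv_eq_convolution]
  exact hc.continuous_convolution_right _ hf hκ

theorem conv_integrable {κ f : Cyl → ℝ} (hκ : Integrable κ) (hf : Integrable f) :
    Integrable (conv κ f) := by
  rw [conv_eq_convolution]
  exact hf.integrable_convolution _ hκ

theorem integral_conv {κ f : Cyl → ℝ} (hκ : Integrable κ) (hf : Integrable f) :
    ∫ z, conv κ f z = (∫ z, f z) * ∫ z, κ z := by
  rw [conv_eq_convolution, integral_convolution _ hf hκ]
  simp

theorem abs_conv_le (κ f : Cyl → ℝ) (z : Cyl) :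
    |conv κ f z| ≤ conv (fun z => |κ z|) (fun z => |f z|) z := by
  simp only [conv, ← abs_mul]
  exact abs_integral_le_integral_abs

theorem integral_abs_conv_le {κ f : Cyl → ℝ} (hκ : Integrable κ) (hf : Integrable f) :
    ∫ z, |conv κ f z| ≤ (∫ z, |f z|) * ∫ z, |κ z| := by
  rw [← integral_conv hκ.abs hf.abs]
  exact integral_mono (conv_integrable hκ hf).abs (conv_integrable hκ.abs hf.abs)
    (abs_conv_le κ f)

theorem memLp_reflect {κ : Cyl → ℝ} (hκ : MemLp κ 2) (z : Cyl) :
    MemLp (fun z' => κ (z - z')) 2 :=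
  hκ.comp_measurePreserving (Measure.measurePreserving_sub_left volume z)

theorem integrable_conv {κ f : Cyl → ℝ} (hκ : MemLp κ 2) (hf : MemLp f 2) (z : Cyl) :
    Integrable (fun z' => f z' * κ (z - z')) := integrable_mul hf (memLp_reflect hκ z)

theorem l2_reflect (κ : Cyl → ℝ) (hκ : MemLp κ 2) (z : Cyl) :
    l2 (fun z' => κ (z - z')) = l2 κ := by
  rw [l2, l2]
  congr 1
  exact eLpNorm_comp_measurePreserving hκ.1 (Measure.measurePreserving_sub_left volume z)

theorem abs_conv_le_l2 {κ f : Cyl → ℝ} (hκ : MemLp κ 2) (hf : MemLp f 2) (z : Cyl) :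
    |conv κ f z| ≤ l2 f * l2 κ := by
  rw [← l2_reflect κ hκ z]
  exact abs_integral_mul_le hf (memLp_reflect hκ z)

/-- Cauchy–Schwarz after splitting |κ| = √|κ| · √|κ|. Integrated in `z`, it gives Young's inequality
from `L¹ ∗ L²` to `L²`. -/
theorem conv_sq_le {κ f : Cyl → ℝ} (hκ : Continuous κ) (hc : HasCompactSupport κ)
    (hf : MemLp f 2) (z : Cyl) :
    conv κ f z ^ 2 ≤ conv (fun z => |κ z|) (fun z => f z ^ 2) z * ∫ z, |κ z| := by
  set b : Cyl → ℝ := fun z' => Real.sqrt |κ (z - z')| with hb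
  have hcr : HasCompactSupport (fun z' => κ (z - z')) :=
    hc.comp_homeomorph (Homeomorph.subLeft z)
  have hbc : Continuous b := by fun_prop
  have hbs : HasCompactSupport b := hcr.comp_left (g := fun r : ℝ => Real.sqrt |r|) (by simp)
  have hbm : MemLp b 2 := hbc.memLp_of_hasCompactSupport hbs
  obtain ⟨C, hC⟩ := hbs.exists_bound_of_continuous hbc
  have ha : MemLp (fun z' => b z' * |f z'|) 2 :=
    memLp_bdd_mul hbc.aestronglyMeasurable (Eventually.of_forall hC) hf.norm
  have hbb : ∀ z', b z' * b z' = |κ (z - z')| := fun z' => Real.mul_self_sqrt (abs_nonneg _)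
  have h1 : |conv κ f z| ≤ ∫ z', (b z' * |f z'|) * b z' := by
    refine (abs_conv_le κ f z).trans (le_of_eq ?_)
    refine integral_congr_ae (Eventually.of_forall fun z' => ?_)
    show |f z'| * |κ (z - z')| = _
    rw [← hbb]; ring
  have h2 := abs_integral_mul_le ha hbm
  have h3 : |conv κ f z| ≤ l2 (fun z' => b z' * |f z'|) * l2 b :=
    h1.trans ((le_abs_self _).trans h2)
  have h4 : conv κ f z ^ 2 ≤ (l2 (fun z' => b z' * |f z'|) * l2 b) ^ 2 := by
    rw [← sq_abs]
    exact pow_le_pow_left₀ (abs_nonneg _) h3 2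
  rw [mul_pow, l2_sq ha, l2_sq hbm] at h4
  refine h4.trans (le_of_eq ?_)
  congr 1
  · refine integral_congr_ae (Eventually.of_forall fun z' => ?_)
    show (b z' * |f z'|) ^ 2 = f z' ^ 2 * |κ (z - z')|
    rw [← hbb, mul_pow, sq_abs]; ring
  · rw [← integral_sub_left_eq_self (fun z => |κ z|) volume z]
    refine integral_congr_ae (Eventually.of_forall fun z' => ?_)
    show b z' ^ 2 = |κ (z - z')|
    rw [← hbb, sq]

theorem conv_memLp {κ f : Cyl → ℝ} (hκ : Continuous κ) (hc : HasCompactSupport κ)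
    (hf : MemLp f 2) : MemLp (conv κ f) 2 := by
  have hcont : Continuous (conv κ f) :=
    conv_continuous hκ hc (hf.locallyIntegrable (by norm_num))
  have hκi : Integrable κ := hκ.integrable_of_hasCompactSupport hc
  rw [memLp_two_iff_integrable_sq hcont.aestronglyMeasurable]
  refine Integrable.mono' ((conv_integrable hκi.abs (integrable_sq hf)).mul_const
    (∫ z, |κ z|)) (hcont.pow 2).aestronglyMeasurable (Eventually.of_forall fun z => ?_)
  rw [Real.norm_eq_abs, abs_of_nonneg (sq_nonneg _)]
  exact conv_sq_le hκ hc hf z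

theorem l2_conv_le {κ f : Cyl → ℝ} (hκ : Continuous κ) (hc : HasCompactSupport κ)
    (hf : MemLp f 2) : l2 (conv κ f) ≤ (∫ z, |κ z|) * l2 f := by
  have hκi : Integrable κ := hκ.integrable_of_hasCompactSupport hc
  have h0 : 0 ≤ ∫ z, |κ z| := integral_nonneg fun _ => abs_nonneg _
  refine l2_le_of_integral_sq_le (conv_memLp hκ hc hf) (mul_nonneg h0 (l2_nonneg f)) ?_
  refine (integral_mono (integrable_sq (conv_memLp hκ hc hf))
    ((conv_integrable hκi.abs (integrable_sq hf)).mul_const (∫ z, |κ z|))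
    (conv_sq_le hκ hc hf)).trans (le_of_eq ?_)
  rw [integral_mul_const, integral_conv hκi.abs (integrable_sq hf), mul_pow, l2_sq hf]
  ring

theorem conv_sub_right {κ f g : Cyl → ℝ} (hκ : MemLp κ 2) (hf : MemLp f 2) (hg : MemLp g 2) :
    conv κ (fun z => f z - g z) = fun z => conv κ f z - conv κ g z := by
  funext z
  simp only [conv]
  rw [← integral_sub (integrable_conv hκ hf z) (integrable_conv hκ hg z)]
  simp only [sub_mul]

theorem conv_sub_left {κ κ' f : Cyl → ℝ} (hκ : MemLp κ 2) (hκ' : MemLp κ' 2) (hf : MemLp f 2) :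
    conv (fun z => κ z - κ' z) f = fun z => conv κ f z - conv κ' f z := by
  funext z
  simp only [conv]
  rw [← integral_sub (integrable_conv hκ hf z) (integrable_conv hκ' hf z)]
  simp only [mul_sub]

theorem integrable_indicator_mul {f : Cyl → ℝ} (hf : MemLp f 2) {S : Set Cyl} (hS : IsCompact S)
    (C : ℝ) : Integrable (fun z => S.indicator (fun z => |f z| * C) z) := by
  rw [integrable_indicator_iff hS.measurableSet]
  exact (((hf.locallyIntegrable (by norm_num)).integrableOn_isCompact hS).abs.mul_const C)

theorem conv_hasDx {κ f : Cyl → ℝ} (hκ : IsTest κ) (hf : MemLp f 2) :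
    HasDx (conv κ f) (conv (dx κ) f) := by
  intro x y
  obtain ⟨C, hC⟩ := hκ.dx.exists_bound
  -- `S` contains every point where the differentiated integrand is nonzero for some `s` within 1 of
  -- `x`. It is compact, so `f` is integrable on it and supplies the dominating function.
  set S : Set Cyl := (fun p : ℝ × Cyl => ((p.1, y) : Cyl) - p.2) ''
    (Set.Icc (x - 1) (x + 1) ×ˢ tsupport (dx κ)) with hSdef
  have hS : IsCompact S := by
    refine ((isCompact_Icc.prod hκ.dx.compact_support.isCompact)).image ?_
    fun_prop
  have key := hasDerivAt_integral_of_dominated_loc_of_deriv_le (μ := (volume : Measure Cyl))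
    (F := fun s z' => f z' * κ ((s, y) - z')) (F' := fun s z' => f z' * dx κ ((s, y) - z'))
    (x₀ := x) (s := Set.Icc (x - 1) (x + 1))
    (bound := fun z' => S.indicator (fun z => |f z| * C) z')
    (Icc_mem_nhds (by linarith) (by linarith))
    (Eventually.of_forall fun s => (integrable_conv (hκ.memLp 2) hf (s, y)).1)
    (integrable_conv (hκ.memLp 2) hf (x, y))
    (integrable_conv (hκ.dx.memLp 2) hf (x, y)).1
    (Eventually.of_forall fun z' s hs => ?_)
    (integrable_indicator_mul hf hS C)
    (Eventually.of_forall fun z' s hs => ?_)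
  · exact key.2
  · by_cases hz : z' ∈ S
    · rw [Set.indicator_of_mem hz, norm_mul]
      exact mul_le_mul_of_nonneg_left (hC _) (abs_nonneg _)
    · rw [Set.indicator_of_notMem hz]
      have : dx κ ((s, y) - z') = 0 := by
        by_contra hne
        apply hz
        refine ⟨(s, (s, y) - z'), ⟨hs, subset_tsupport _ hne⟩, ?_⟩
        simp
      rw [this]; simp
  · have h1 := hκ.hasDx (s - z'.1) (y - z'.2)
    have h2 := HasDerivAt.comp_sub_const (f := fun r : ℝ => κ (r, y - z'.2)) s z'.1 h1
    exact h2.const_mul (f z')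

theorem conv_hasDy {κ f : Cyl → ℝ} (hκ : IsTest κ) (hf : MemLp f 2) :
    HasDy (conv κ f) (conv (dy κ) f) := by
  intro x y
  have hmk : Continuous (fun s : ℝ => (s : Torus)) := AddCircle.continuous_mk' _
  obtain ⟨C, hC⟩ := hκ.dy.exists_bound
  set S : Set Cyl := (fun p : ℝ × Cyl => ((x, (p.1 : Torus)) : Cyl) - p.2) ''
    (Set.Icc (y - 1) (y + 1) ×ˢ tsupport (dy κ)) with hSdef
  have hS : IsCompact S := by
    refine ((isCompact_Icc.prod hκ.dy.compact_support.isCompact)).image ?_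
    fun_prop
  have key := hasDerivAt_integral_of_dominated_loc_of_deriv_le (μ := (volume : Measure Cyl))
    (F := fun (s : ℝ) z' => f z' * κ ((x, (s : Torus)) - z'))
    (F' := fun (s : ℝ) z' => f z' * dy κ ((x, (s : Torus)) - z'))
    (x₀ := y) (s := Set.Icc (y - 1) (y + 1))
    (bound := fun z' => S.indicator (fun z => |f z| * C) z')
    (Icc_mem_nhds (by linarith) (by linarith))
    (Eventually.of_forall fun s => (integrable_conv (hκ.memLp 2) hf (x, (s : Torus))).1)
    (integrable_conv (hκ.memLp 2) hf (x, (y : Torus)))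
    (integrable_conv (hκ.dy.memLp 2) hf (x, (y : Torus))).1
    (Eventually.of_forall fun z' s hs => ?_)
    (integrable_indicator_mul hf hS C)
    (Eventually.of_forall fun z' s hs => ?_)
  · exact key.2
  · by_cases hz : z' ∈ S
    · rw [Set.indicator_of_mem hz, norm_mul]
      exact mul_le_mul_of_nonneg_left (hC _) (abs_nonneg _)
    · rw [Set.indicator_of_notMem hz]
      have : dy κ ((x, (s : Torus)) - z') = 0 := by
        by_contra hne
        apply hz
        refine ⟨(s, (x, (s : Torus)) - z'), ⟨hs, subset_tsupport _ hne⟩, ?_⟩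
        simp
      rw [this]; simp
  · obtain ⟨r, hr⟩ := exists_lift z'.2
    have h1 := hκ.hasDy (x - z'.1) (s - r)
    have h2 := HasDerivAt.comp_sub_const (f := fun r : ℝ => κ (x - z'.1, (r : Torus))) s r h1
    have h3 := h2.const_mul (f z')
    simp only [AddCircle.coe_sub, hr] at h3
    exact h3

theorem iterate_dx_neg (a : ℕ) (f : Cyl → ℝ) : dx^[a] (fun z => -f z) = fun z => -(dx^[a] f) z := by
  induction a generalizing f with
  | zero => rfl
  | succ a ih => rw [Function.iterate_succ_apply, Function.iterate_succ_apply, dx_neg, ih]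

theorem iterate_dx_reflect (a : ℕ) (κ : Cyl → ℝ) (z : Cyl) :
    dx^[a] (fun z' => κ (z - z')) = fun z' => (-1) ^ a * (dx^[a] κ) (z - z') := by
  induction a generalizing κ with
  | zero => simp
  | succ a ih =>
    rw [Function.iterate_succ_apply, Function.iterate_succ_apply, dx_reflect, iterate_dx_neg, ih]
    funext z'
    ring

theorem iterate_dx_const_mul (a : ℕ) (c : ℝ) (f : Cyl → ℝ) :
    dx^[a] (fun z => c * f z) = fun z => c * (dx^[a] f) z := by
  induction a generalizing f with
  | zero => rfl
  | succ a ih => rw [Function.iterate_succ_apply, Function.iterate_succ_apply, dx_const_mul, ih]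

theorem iterate_dy_const_mul (a : ℕ) (c : ℝ) (f : Cyl → ℝ) :
    dy^[a] (fun z => c * f z) = fun z => c * (dy^[a] f) z := by
  induction a generalizing f with
  | zero => rfl
  | succ a ih => rw [Function.iterate_succ_apply, Function.iterate_succ_apply, dy_const_mul, ih]

theorem iterate_dy_reflect (a : ℕ) (κ : Cyl → ℝ) (z : Cyl) :
    dy^[a] (fun z' => κ (z - z')) = fun z' => (-1) ^ a * (dy^[a] κ) (z - z') := by
  induction a generalizing κ with
  | zero => simp
  | succ a ih =>
    rw [Function.iterate_succ_apply, Function.iterate_succ_apply, dy_reflect]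
    have : (fun z' => -dy κ (z - z')) = fun z' => (-1) * dy κ (z - z') := by funext; ring
    rw [this, iterate_dy_const_mul, ih]
    funext z'
    ring

/-- The sign `(-1)^(a+b)` from reflecting the kernel cancels the one in the definition of weak
derivative. Norms of derivatives of mollifications are thus bounded uniformly in the kernel. -/
theorem conv_iterate_of_hasWeakDeriv {a b : ℕ} {f g : L2} (h : HasWeakDeriv a b f g)
    {κ : Cyl → ℝ} (hκ : IsTest κ) : conv (dx^[a] (dy^[b] κ)) f = conv κ g := by
  funext z
  have h1 := h _ (hκ.reflect z)
  rw [iterate_dy_reflect, iterate_dx_const_mul, iterate_dx_reflect] at h1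
  have h2 : (fun z' => f z' * ((-1) ^ b * ((-1) ^ a * (dx^[a] (dy^[b] κ)) (z - z'))))
      = fun z' => (-1 : ℝ) ^ (a + b) * (f z' * (dx^[a] (dy^[b] κ)) (z - z')) := by
    funext z'; ring
  rw [h2, integral_const_mul] at h1
  exact mul_left_cancel₀ (pow_ne_zero _ (by norm_num)) h1

end Conv


/-! ### Product rules and classes of functions stable under multiplication. -/

section Calculus

theorem HasDx.mul {F F' G G' : Cyl → ℝ} (hF : HasDx F F') (hG : HasDx G G') :
    HasDx (fun z => F z * G z) (fun z => F' z * G z + F z * G' z) :=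
  fun x y => (hF x y).mul (hG x y)

theorem HasDy.mul {F F' G G' : Cyl → ℝ} (hF : HasDy F F') (hG : HasDy G G') :
    HasDy (fun z => F z * G z) (fun z => F' z * G z + F z * G' z) :=
  fun x y => (hF x y).mul (hG x y)

theorem HasDy.add {F F' G G' : Cyl → ℝ} (hF : HasDy F F') (hG : HasDy G G') :
    HasDy (fun z => F z + G z) (fun z => F' z + G' z) :=
  fun x y => (hF x y).add (hG x y)

theorem hasDx_fst {X X' : ℝ → ℝ} (h : ∀ x, HasDerivAt X (X' x) x) :
    HasDx (fun z => X z.1) (fun z => X' z.1) := fun x _ => h x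

theorem hasDy_fst (X : ℝ → ℝ) : HasDy (fun z => X z.1) (fun _ => 0) :=
  fun x y => hasDerivAt_const y (X x)

/-- Continuous bounded functions on the cylinder. -/
structure BddCont (F : Cyl → ℝ) : Prop where
  cont : Continuous F
  bound : ∃ C, ∀ z, |F z| ≤ C

/-- Continuous bounded square integrable functions on the cylinder. -/
structure Nice (F : Cyl → ℝ) : Prop extends BddCont F where
  memLp : MemLp F 2

theorem BddCont.mul {F G : Cyl → ℝ} (hF : BddCont F) (hG : BddCont G) :
    BddCont (fun z => F z * G z) where
  cont := hF.cont.mul hG.cont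
  bound := by
    obtain ⟨C, hC⟩ := hF.bound
    obtain ⟨D, hD⟩ := hG.bound
    refine ⟨C * D, fun z => ?_⟩
    rw [abs_mul]
    exact mul_le_mul (hC z) (hD z) (abs_nonneg _) ((abs_nonneg _).trans (hC z))

theorem BddCont.add {F G : Cyl → ℝ} (hF : BddCont F) (hG : BddCont G) :
    BddCont (fun z => F z + G z) where
  cont := hF.cont.add hG.cont
  bound := by
    obtain ⟨C, hC⟩ := hF.bound
    obtain ⟨D, hD⟩ := hG.bound
    exact ⟨C + D, fun z => (abs_add_le _ _).trans (add_le_add (hC z) (hD z))⟩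

theorem BddCont.mul_nice {F G : Cyl → ℝ} (hF : BddCont F) (hG : Nice G) :
    Nice (fun z => F z * G z) where
  toBddCont := hF.mul hG.toBddCont
  memLp := by
    obtain ⟨C, hC⟩ := hF.bound
    exact memLp_bdd_mul hF.cont.aestronglyMeasurable (Eventually.of_forall hC) hG.memLp

theorem Nice.mul_bdd {F G : Cyl → ℝ} (hG : Nice G) (hF : BddCont F) :
    Nice (fun z => G z * F z) := by
  simpa only [mul_comm] using hF.mul_nice hG

theorem Nice.mul {F G : Cyl → ℝ} (hF : Nice F) (hG : Nice G) : Nice (fun z => F z * G z) :=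
  hF.toBddCont.mul_nice hG

theorem Nice.add {F G : Cyl → ℝ} (hF : Nice F) (hG : Nice G) : Nice (fun z => F z + G z) where
  toBddCont := hF.toBddCont.add hG.toBddCont
  memLp := hF.memLp.add hG.memLp

theorem Nice.const_mul {F : Cyl → ℝ} (hF : Nice F) (c : ℝ) : Nice (fun z => c * F z) :=
  BddCont.mul_nice ⟨continuous_const, |c|, fun _ => le_rfl⟩ hF

theorem Nice.integrable_mul {F G : Cyl → ℝ} (hF : Nice F) (hG : Nice G) :
    Integrable (fun z => F z * G z) := KP.integrable_mul hF.memLp hG.memLp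

theorem Nice.integrable_mul_bdd {F G H : Cyl → ℝ} (hF : Nice F) (hG : Nice G) (hH : BddCont H) :
    Integrable (fun z => F z * G z * H z) := by
  simpa only [mul_assoc] using hF.integrable_mul (hG.mul_bdd hH)

theorem bddCont_fst {X : ℝ → ℝ} (hX : Continuous X) (hb : ∃ C, ∀ x, |X x| ≤ C) :
    BddCont (fun z => X z.1) :=
  ⟨hX.comp continuous_fst, hb.imp fun _ h z => h z.1⟩

end Calculus

/-! ### One-dimensional inequalities on slices of the cylinder. -/

section Integrals

theorem ae_snd {p : Torus → Prop} (h : ∀ᵐ y, p y) : ∀ᵐ z : Cyl, p z.2 :=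
  (Measure.quasiMeasurePreserving_snd (μ := (volume : Measure ℝ))
    (ν := (volume : Measure Torus))).ae h

theorem ae_integrable_section {F : Cyl → ℝ} (hF : Integrable F) :
    ∀ᵐ y : Torus, Integrable (fun x : ℝ => F (x, y)) := hF.prod_left_ae

theorem integral_cyl {F : Cyl → ℝ} (hF : Integrable F) :
    ∫ z, F z = ∫ y : Torus, ∫ x : ℝ, F (x, y) := integral_prod_symm F hF

theorem integrable_integral_x {F : Cyl → ℝ} (hF : Integrable F) :
    Integrable (fun y : Torus => ∫ x : ℝ, F (x, y)) := Integrable.integral_prod_right hF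

theorem integrable_integral_x_abs {F : Cyl → ℝ} (hF : Integrable F) :
    Integrable (fun y : Torus => ∫ x : ℝ, |F (x, y)|) :=
  integrable_integral_x (F := fun z => |F z|) hF.abs

theorem integral_abs_integral_x_le {F : Cyl → ℝ} (hF : Integrable F) :
    ∫ y : Torus, |∫ x : ℝ, F (x, y)| ≤ ∫ z, |F z| := by
  rw [integral_cyl (F := fun z => |F z|) hF.abs]
  refine integral_mono (integrable_integral_x hF).abs (integrable_integral_x_abs hF) fun y => ?_
  exact abs_integral_le_integral_abs

theorem ae_integral_dx_eq_zero {F F' : Cyl → ℝ} (h : HasDx F F') (hF : Integrable F)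
    (hF' : Integrable F') : ∀ᵐ y : Torus, ∫ x : ℝ, F' (x, y) = 0 := by
  filter_upwards [ae_integrable_section hF, ae_integrable_section hF'] with y h1 h2
  exact integral_eq_zero_of_hasDerivAt_of_integrable (fun x => h x y) h2 h1

theorem integral_dx_eq_zero {F F' : Cyl → ℝ} (h : HasDx F F') (hF : Integrable F)
    (hF' : Integrable F') : ∫ z, F' z = 0 := by
  rw [integral_cyl hF', integral_congr_ae (ae_integral_dx_eq_zero h hF hF')]
  simp

theorem continuous_section_y {F : Cyl → ℝ} (hF : Continuous F) (x : ℝ) :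
    Continuous (fun s : ℝ => F (x, (s : Torus))) := by
  have hmk : Continuous (fun s : ℝ => (s : Torus)) := AddCircle.continuous_mk' _
  fun_prop

theorem integral_dy_eq_zero {F F' : Cyl → ℝ} (h : HasDy F F') (hF' : Integrable F')
    (hc : Continuous F') : ∫ z, F' z = 0 := by
  have h1 : ∫ z, F' z = ∫ x : ℝ, ∫ y : Torus, F' (x, y) := integral_prod F' hF'
  have h2 : ∀ x : ℝ, ∫ y : Torus, F' (x, y) = 0 := by
    intro x
    rw [← AddCircle.intervalIntegral_preimage (2 * Real.pi) 0 (fun y => F' (x, y)),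
      intervalIntegral.integral_eq_sub_of_hasDerivAt (f := fun s : ℝ => F (x, (s : Torus)))
        (fun s _ => h x s) ((continuous_section_y hc x).intervalIntegrable _ _)]
    rw [zero_add, AddCircle.coe_period, AddCircle.coe_zero, sub_self]
  rw [h1]
  simp [h2]

theorem ae_abs_le_integral_dx {F F' : Cyl → ℝ} (h : HasDx F F') (hF : Integrable F)
    (hF' : Integrable F') : ∀ᵐ y : Torus, ∀ x, |F (x, y)| ≤ ∫ s : ℝ, |F' (s, y)| := by
  filter_upwards [ae_integrable_section hF, ae_integrable_section hF'] with y h1 h2 x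
  have h3 := tendsto_zero_of_hasDerivAt_of_integrableOn_Iic (a := x) (fun s _ => h s y)
    h2.integrableOn h1.integrableOn
  have h4 := integral_Iic_of_hasDerivAt_of_tendsto' (a := x) (fun s _ => h s y)
    h2.integrableOn h3
  rw [sub_zero] at h4
  rw [← h4]
  exact abs_integral_le_integral_abs.trans
    (setIntegral_le_integral h2.abs (Eventually.of_forall fun _ => abs_nonneg _))

/-- The absolute value on the right stays outside the `x`-integral. This leaves room to integrate by
parts in `x` before estimating, as the cubic estimate requires. -/
theorem integral_x_sub_le {F F' : Cyl → ℝ} (h : HasDy F F') (hF' : Integrable F')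
    (hc : Continuous F') {y₀ y₁ : Torus} (h₀ : Integrable (fun x : ℝ => F (x, y₀)))
    (h₁ : Integrable (fun x : ℝ => F (x, y₁))) :
    |(∫ x : ℝ, F (x, y₁)) - ∫ x : ℝ, F (x, y₀)| ≤ ∫ y : Torus, |∫ x : ℝ, F' (x, y)| := by
  obtain ⟨a, rfl⟩ := exists_lift y₀
  -- The lift of `y₁` is chosen within one period after `a`, so that the path from `a` to `b` covers
  -- the torus at most once.
  obtain ⟨b, hb, rfl⟩ : ∃ b ∈ Set.Ioc a (a + 2 * Real.pi), (b : Torus) = y₁ :=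
    ⟨_, (AddCircle.equivIoc (2 * Real.pi) a y₁).2, AddCircle.coe_equivIoc⟩
  have hmp : MeasurePreserving (Prod.map id ((↑) : ℝ → Torus))
      ((volume : Measure ℝ).prod (volume.restrict (Set.Ioc a (a + 2 * Real.pi))))
      (volume : Measure Cyl) :=
    (MeasurePreserving.id (volume : Measure ℝ)).prod
      (AddCircle.measurePreserving_mk (2 * Real.pi) a)
  have hi : Integrable (fun p : ℝ × ℝ => F' (p.1, (p.2 : Torus)))
      ((volume : Measure ℝ).prod (volume.restrict (Set.Ioc a (a + 2 * Real.pi)))) :=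
    hmp.integrable_comp_of_integrable hF'
  have hle : (volume : Measure ℝ).restrict (Set.Ioc a b) ≤
      volume.restrict (Set.Ioc a (a + 2 * Real.pi)) :=
    Measure.restrict_mono (Set.Ioc_subset_Ioc_right hb.2) le_rfl
  have hi' : Integrable (fun p : ℝ × ℝ => F' (p.1, (p.2 : Torus)))
      ((volume : Measure ℝ).prod (volume.restrict (Set.Ioc a b))) :=
    hi.mono_measure (Measure.prod_mono le_rfl hle)
  have h2 : ∀ x : ℝ, F (x, (b : Torus)) - F (x, (a : Torus))
      = ∫ s in Set.Ioc a b, F' (x, (s : Torus)) := by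
    intro x
    rw [← intervalIntegral.integral_of_le hb.1.le]
    exact (intervalIntegral.integral_eq_sub_of_hasDerivAt (fun s _ => h x s)
      ((continuous_section_y hc x).intervalIntegrable _ _)).symm
  rw [← integral_sub h₁ h₀]
  simp only [h2]
  rw [integral_integral_swap hi']
  refine abs_integral_le_integral_abs.trans ?_
  rw [← AddCircle.integral_preimage (2 * Real.pi) a (fun y => |∫ x : ℝ, F' (x, y)|)]
  refine integral_mono_measure hle (Eventually.of_forall fun _ => abs_nonneg _) ?_
  exact ((AddCircle.measurePreserving_mk (2 * Real.pi) a).integrable_comp_of_integrable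
    (integrable_integral_x hF')).abs

/-- Fix y₀ and average the preceding bound over y₁: the value at y₀ exceeds the mean over the torus
by at most the total variation in `y`. -/
theorem ae_integral_x_le {F F' : Cyl → ℝ} (h : HasDy F F') (hF : Integrable F)
    (hF' : Integrable F') (hc : Continuous F') :
    ∀ᵐ y : Torus, ∫ x : ℝ, F (x, y) ≤
      (2 * Real.pi)⁻¹ * (∫ z, F z) + ∫ y : Torus, |∫ x : ℝ, F' (x, y)| := by
  set B := ∫ y : Torus, |∫ x : ℝ, F' (x, y)|
  filter_upwards [ae_integrable_section hF] with y₀ h₀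
  have h1 : ∫ _ : Torus, (∫ x : ℝ, F (x, y₀)) - B ≤ ∫ y : Torus, ∫ x : ℝ, F (x, y) := by
    refine integral_mono_ae (integrable_const _) (integrable_integral_x hF) ?_
    filter_upwards [ae_integrable_section hF] with y₁ h₁
    have := (abs_le.1 (integral_x_sub_le h hF' hc h₀ h₁)).1
    simp only [B]
    linarith
  rw [← integral_cyl hF, integral_const, measureReal_def, AddCircle.measure_univ,
    ENNReal.toReal_ofReal Real.two_pi_pos.le, smul_eq_mul] at h1
  have h2 : (∫ x : ℝ, F (x, y₀)) - B ≤ (2 * Real.pi)⁻¹ * ∫ z, F z := by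
    rw [inv_mul_eq_div, le_div_iff₀ Real.two_pi_pos]
    linarith
  linarith

theorem inv_two_pi_le_one : (2 * Real.pi)⁻¹ ≤ 1 :=
  inv_le_one_of_one_le₀ (by linarith [Real.pi_gt_three])

/-- On each slice ∫ F² dx ≤ (sup_x F) ∫ F dx. The supremum is controlled by ∫ |F_x| dx, and the last
factor by `B` uniformly in `y`. -/
theorem integral_sq_le_of_integral_x_le {F F' : Cyl → ℝ} (h : HasDx F F') (hF0 : ∀ z, 0 ≤ F z)
    (hF : Integrable F) (hF' : Integrable F') (hF2 : Integrable (fun z => F z ^ 2)) {B : ℝ}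
    (hB : ∀ᵐ y : Torus, ∫ x : ℝ, F (x, y) ≤ B) :
    ∫ z, F z ^ 2 ≤ (∫ z, |F' z|) * B := by
  rw [integral_cyl (F := fun z => F z ^ 2) hF2, integral_cyl (F := fun z => |F' z|) hF'.abs,
    ← integral_mul_const]
  refine integral_mono_ae (integrable_integral_x (F := fun z => F z ^ 2) hF2)
    ((integrable_integral_x_abs hF').mul_const B) ?_
  filter_upwards [hB, ae_abs_le_integral_dx h hF hF', ae_integrable_section hF,
    ae_integrable_section hF2] with y h1 h2 h3 h4
  have h5 : ∫ x : ℝ, F (x, y) ^ 2 ≤ ∫ x : ℝ, (∫ s : ℝ, |F' (s, y)|) * F (x, y) := by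
    refine integral_mono h4 (h3.const_mul _) fun x => ?_
    show F (x, y) ^ 2 ≤ _
    rw [sq]
    exact mul_le_mul_of_nonneg_right ((le_abs_self _).trans (h2 x)) (hF0 _)
  rw [integral_const_mul] at h5
  exact h5.trans (mul_le_mul_of_nonneg_left h1 (integral_nonneg fun _ => abs_nonneg _))

end Integrals

/-! ### A Sobolev inequality and the weighted cubic estimate. -/

section Sobolev

/-- In `x`, w² ≤ ∫ |(w²)_x| dx ≤ E(y) with E(y) = ∫ (w² + w_x²) dx. In `y`, E is bounded by its mean
plus the integral of |E'|, which brings in w_y and w_xy. -/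
theorem ae_sq_le_sobolev {w wx wy wxy : Cyl → ℝ} (hw : Nice w) (hwx : Nice wx) (hwy : Nice wy)
    (hwxy : Nice wxy) (h1 : HasDx w wx) (h2 : HasDy w wy) (h3 : HasDy wx wxy) :
    ∀ᵐ z, w z ^ 2 ≤ 2 * (l2 w ^ 2 + l2 wx ^ 2 + l2 wy ^ 2 + l2 wxy ^ 2) := by
  have a1 := ae_abs_le_integral_dx (h1.mul h1) (hw.integrable_mul hw)
    ((hwx.integrable_mul hw).add (hw.integrable_mul hwx))
  have hE : Integrable (fun z => w z * w z + wx z * wx z) :=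
    (hw.integrable_mul hw).add (hwx.integrable_mul hwx)
  have hE' : Integrable (fun z => (wy z * w z + w z * wy z) + (wxy z * wx z + wx z * wxy z)) :=
    ((hwy.integrable_mul hw).add (hw.integrable_mul hwy)).add
      ((hwxy.integrable_mul hwx).add (hwx.integrable_mul hwxy))
  have hc : Continuous (fun z => (wy z * w z + w z * wy z) + (wxy z * wx z + wx z * wxy z)) := by
    have := hw.cont; have := hwx.cont; have := hwy.cont; have := hwxy.cont
    fun_prop
  have a2 := ae_integral_x_le ((h2.mul h2).add (h3.mul h3)) hE hE' hc
  have e0 : ∫ z, (w z * w z + wx z * wx z) = l2 w ^ 2 + l2 wx ^ 2 := by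
    rw [l2_sq hw.memLp, l2_sq hwx.memLp, ← integral_add (integrable_sq hw.memLp)
      (integrable_sq hwx.memLp)]
    simp only [sq]
  have e1 : ∫ z, |(wy z * w z + w z * wy z) + (wxy z * wx z + wx z * wxy z)| ≤
      l2 w ^ 2 + l2 wx ^ 2 + l2 wy ^ 2 + l2 wxy ^ 2 := by
    have i2 : Integrable (fun z => w z ^ 2 + wx z ^ 2) :=
      (integrable_sq hw.memLp).add (integrable_sq hwx.memLp)
    have i3 : Integrable (fun z => w z ^ 2 + wx z ^ 2 + wy z ^ 2) :=
      i2.add (integrable_sq hwy.memLp)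
    have i4 : Integrable (fun z => w z ^ 2 + wx z ^ 2 + wy z ^ 2 + wxy z ^ 2) :=
      i3.add (integrable_sq hwxy.memLp)
    rw [l2_sq hw.memLp, l2_sq hwx.memLp, l2_sq hwy.memLp, l2_sq hwxy.memLp,
      ← integral_add (integrable_sq hw.memLp) (integrable_sq hwx.memLp),
      ← integral_add i2 (integrable_sq hwy.memLp), ← integral_add i3 (integrable_sq hwxy.memLp)]
    refine integral_mono hE'.abs i4 fun z => ?_
    show |_| ≤ _
    rw [abs_le]
    constructor <;>
      nlinarith [sq_nonneg (w z + wy z), sq_nonneg (w z - wy z), sq_nonneg (wx z + wxy z),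
        sq_nonneg (wx z - wxy z)]
  have e2 := integral_abs_integral_x_le hE'
  have key : ∀ᵐ y : Torus, ∀ x, w (x, y) ^ 2 ≤
      2 * (l2 w ^ 2 + l2 wx ^ 2 + l2 wy ^ 2 + l2 wxy ^ 2) := by
    filter_upwards [a1, a2, ae_integrable_section hE, ae_integrable_section
      ((hwx.integrable_mul hw).add (hw.integrable_mul hwx))] with y b1 b2 b3 b4 x
    have c1 : ∫ s : ℝ, |wx (s, y) * w (s, y) + w (s, y) * wx (s, y)| ≤
        ∫ s : ℝ, w (s, y) * w (s, y) + wx (s, y) * wx (s, y) := by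
      refine integral_mono b4.abs b3 fun s => ?_
      show |_| ≤ _
      rw [abs_le]
      constructor <;> nlinarith [sq_nonneg (w (s, y) + wx (s, y)), sq_nonneg (w (s, y) - wx (s, y))]
    have c2 := b1 x
    have c3 : (2 * Real.pi)⁻¹ * ∫ z, (w z * w z + wx z * wx z) ≤ l2 w ^ 2 + l2 wx ^ 2 := by
      rw [e0]
      exact mul_le_of_le_one_left (by positivity) inv_two_pi_le_one
    have c4 := (le_abs_self _).trans c2
    have c5 : 0 ≤ l2 wy ^ 2 + l2 wxy ^ 2 := by positivity
    rw [sq]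
    linarith
  filter_upwards [ae_snd key] with z hz
  exact hz z.1

/-- The anisotropic weighted estimate `|∫ w³ψ| ≤ 3 ‖w‖ ∫ ψ (w² + (∂ₓw)² + v²)`, where
`∂ₓ v = ∂_y w`. -/
theorem abs_integral_cube_le {w wx wy v : Cyl → ℝ} (hw : Nice w) (hwx : Nice wx) (hwy : Nice wy)
    (hv : Nice v) (h1 : HasDx w wx) (h2 : HasDy w wy) (h3 : HasDx v wy) {ψ ψ' : ℝ → ℝ}
    (hψ : ∀ x, HasDerivAt ψ (ψ' x) x) (hψ0 : ∀ x, 0 ≤ ψ x) (hψ' : ∀ x, |ψ' x| ≤ ψ x)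
    (hψb : BddCont (fun z => ψ z.1)) (hψb' : BddCont (fun z => ψ' z.1)) :
    |∫ z, w z ^ 3 * ψ z.1| ≤ 3 * l2 w * ∫ z, ψ z.1 * (w z ^ 2 + wx z ^ 2 + v z ^ 2) := by
  set Q := ∫ z, ψ z.1 * (w z ^ 2 + wx z ^ 2 + v z ^ 2) with hQ
  have hQi : Integrable (fun z => ψ z.1 * (w z ^ 2 + wx z ^ 2 + v z ^ 2)) := by
    have := ((hw.integrable_mul_bdd hw hψb).add (hwx.integrable_mul_bdd hwx hψb)).add
      (hv.integrable_mul_bdd hv hψb)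
    refine this.congr (Eventually.of_forall fun z => ?_)
    simp only [Pi.add_apply]; ring
  have hQ0 : 0 ≤ Q := integral_nonneg fun z => mul_nonneg (hψ0 _) (by positivity)
  -- The slice inequalities are applied to F = w²ψ. The target is ‖F‖ ≤ 3Q in `L²`, since ∫ w³ψ = ∫
  -- wF ≤ ‖w‖ ‖F‖.
  have hFn : Nice (fun z => w z * w z * ψ z.1) := (hw.mul hw).mul_bdd hψb
  have hFi : Integrable (fun z => w z * w z * ψ z.1) := hw.integrable_mul_bdd hw hψb
  have dxψ := hasDx_fst hψ
  have dyψ := hasDy_fst ψ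
  have hFx := (h1.mul h1).mul dxψ
  have hFy := (h2.mul h2).mul dyψ
  have hFxi : Integrable (fun z => (wx z * w z + w z * wx z) * ψ z.1 + w z * w z * ψ' z.1) := by
    have := ((hwx.integrable_mul_bdd hw hψb).add (hw.integrable_mul_bdd hwx hψb)).add
      (hw.integrable_mul_bdd hw hψb')
    refine this.congr (Eventually.of_forall fun z => ?_)
    simp only [Pi.add_apply]; ring
  have hFyi : Integrable (fun z => (wy z * w z + w z * wy z) * ψ z.1 + w z * w z * 0) := by
    have := ((hwy.integrable_mul_bdd hw hψb).add (hw.integrable_mul_bdd hwy hψb))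
    refine this.congr (Eventually.of_forall fun z => ?_)
    simp only [Pi.add_apply]; ring
  have hFyc : Continuous (fun z => (wy z * w z + w z * wy z) * ψ z.1 + w z * w z * 0) :=
    (((hwy.cont.mul hw.cont).add (hw.cont.mul hwy.cont)).mul hψb.cont).add
      ((hw.cont.mul hw.cont).mul continuous_const)
  -- the integral of `∂ₓ`
  have A : ∫ z, |(wx z * w z + w z * wx z) * ψ z.1 + w z * w z * ψ' z.1| ≤ 2 * Q := by
    rw [hQ, ← integral_const_mul]
    refine integral_mono hFxi.abs (hQi.const_mul 2) fun z => ?_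
    have p0 := hψ0 z.1
    have p1 := abs_le.1 (hψ' z.1)
    have m1 := mul_nonneg p0 (sq_nonneg (w z + wx z))
    have m2 := mul_nonneg p0 (sq_nonneg (w z - wx z))
    have m3 := mul_nonneg p0 (sq_nonneg (wx z))
    have m4 := mul_nonneg p0 (sq_nonneg (v z))
    have m5 := mul_le_mul_of_nonneg_right p1.1 (sq_nonneg (w z))
    have m6 := mul_le_mul_of_nonneg_right p1.2 (sq_nonneg (w z))
    show |_| ≤ _
    rw [abs_le]
    constructor <;> nlinarith
  -- the integral over `x` of `∂_y`, after an integration by parts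
  have hP : HasDx (fun z => w z * ψ z.1 * v z)
      (fun z => (wx z * ψ z.1 + w z * ψ' z.1) * v z + w z * ψ z.1 * wy z) := (h1.mul dxψ).mul h3
  have hPi : Integrable (fun z => w z * ψ z.1 * v z) := (hw.mul_bdd hψb).integrable_mul hv
  have hRn : Nice (fun z => wx z * ψ z.1 + w z * ψ' z.1) :=
    (hwx.mul_bdd hψb).add (hw.mul_bdd hψb')
  have hRi : Integrable (fun z => (wx z * ψ z.1 + w z * ψ' z.1) * v z) := hRn.integrable_mul hv
  have hSi : Integrable (fun z => w z * ψ z.1 * wy z) := (hw.mul_bdd hψb).integrable_mul hwy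
  have hP0 := ae_integral_dx_eq_zero hP hPi (hRi.add hSi)
  -- Since w_y = v_x, the slice integral ∫ 2wψ w_y dx equals -∫ 2(wψ)_x v dx, and no `y`-derivative
  -- remains.
  have B1 : ∫ y : Torus, |∫ x : ℝ, ((wy (x, y) * w (x, y) + w (x, y) * wy (x, y)) * ψ x
      + w (x, y) * w (x, y) * 0)| ≤ 2 * Q := by
    have e : ∀ᵐ y : Torus, |∫ x : ℝ, ((wy (x, y) * w (x, y) + w (x, y) * wy (x, y)) * ψ x
      + w (x, y) * w (x, y) * 0)| =
        |∫ x : ℝ, 2 * ((wx (x, y) * ψ x + w (x, y) * ψ' x) * v (x, y))| := by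
      filter_upwards [hP0, ae_integrable_section hRi, ae_integrable_section hSi] with y b1 b2 b3
      rw [integral_add b2 b3] at b1
      rw [integral_const_mul, abs_mul, ← abs_neg (∫ x : ℝ, _ * v (x, y)), ← abs_mul,
        ← eq_neg_iff_add_eq_zero.2 ((add_comm _ _).trans b1), ← integral_const_mul]
      congr 1
      refine integral_congr_ae (Eventually.of_forall fun x => ?_)
      show (wy (x, y) * w (x, y) + w (x, y) * wy (x, y)) * ψ x + w (x, y) * w (x, y) * 0 =
        2 * (w (x, y) * ψ x * wy (x, y))
      ring
    rw [integral_congr_ae e]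
    refine (integral_abs_integral_x_le (F := fun z => 2 * ((wx z * ψ z.1 + w z * ψ' z.1) * v z))
      (hRi.const_mul 2)).trans ?_
    rw [hQ, ← integral_const_mul]
    refine integral_mono (hRi.const_mul 2).abs (hQi.const_mul 2) fun z => ?_
    have p0 := hψ0 z.1
    have q1 : |wx z * ψ z.1 * v z| ≤ ψ z.1 * ((wx z ^ 2 + v z ^ 2) / 2) := by
      rw [show wx z * ψ z.1 * v z = ψ z.1 * (wx z * v z) by ring, abs_mul, abs_of_nonneg p0]
      refine mul_le_mul_of_nonneg_left ?_ p0
      rw [abs_le]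
      constructor <;> nlinarith [sq_nonneg (wx z + v z), sq_nonneg (wx z - v z)]
    have q2 : |w z * ψ' z.1 * v z| ≤ ψ z.1 * ((w z ^ 2 + v z ^ 2) / 2) := by
      rw [show w z * ψ' z.1 * v z = ψ' z.1 * (w z * v z) by ring, abs_mul]
      refine mul_le_mul (hψ' _) ?_ (abs_nonneg _) p0
      rw [abs_le]
      constructor <;> nlinarith [sq_nonneg (w z + v z), sq_nonneg (w z - v z)]
    show |2 * ((wx z * ψ z.1 + w z * ψ' z.1) * v z)| ≤
      2 * (ψ z.1 * (w z ^ 2 + wx z ^ 2 + v z ^ 2))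
    rw [abs_mul, abs_two, add_mul]
    have m1 := mul_nonneg p0 (sq_nonneg (wx z))
    have m2 := mul_nonneg p0 (sq_nonneg (w z))
    have := abs_add_le (wx z * ψ z.1 * v z) (w z * ψ' z.1 * v z)
    nlinarith
  have B2 : ∫ z, w z * w z * ψ z.1 ≤ Q := by
    refine integral_mono hFi hQi fun z => ?_
    have m1 := mul_nonneg (hψ0 z.1) (sq_nonneg (wx z))
    have m2 := mul_nonneg (hψ0 z.1) (sq_nonneg (v z))
    show w z * w z * ψ z.1 ≤ ψ z.1 * (w z ^ 2 + wx z ^ 2 + v z ^ 2)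
    nlinarith
  have hF0 : ∀ z, 0 ≤ w z * w z * ψ z.1 := fun z => mul_nonneg (mul_self_nonneg _) (hψ0 _)
  have B : ∀ᵐ y : Torus, ∫ x : ℝ, w (x, y) * w (x, y) * ψ x ≤ 3 * Q := by
    filter_upwards [ae_integral_x_le hFy hFi hFyi hFyc] with y hy
    have : (2 * Real.pi)⁻¹ * ∫ z, w z * w z * ψ z.1 ≤ Q :=
      (mul_le_of_le_one_left (integral_nonneg hF0) inv_two_pi_le_one).trans B2
    linarith
  -- This gives ∫ F² ≤ 2Q · 3Q ≤ (3Q)².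
  have C := integral_sq_le_of_integral_x_le hFx hF0 hFi hFxi (integrable_sq hFn.memLp) B
  have D : l2 (fun z => w z * w z * ψ z.1) ≤ 3 * Q := by
    refine l2_le_of_integral_sq_le hFn.memLp (by positivity) (C.trans ?_)
    nlinarith [mul_le_mul_of_nonneg_right A (by positivity : (0:ℝ) ≤ 3 * Q), sq_nonneg Q]
  have E := abs_integral_mul_le hw.memLp hFn.memLp
  have e : ∫ z, w z ^ 3 * ψ z.1 = ∫ z, w z * (w z * w z * ψ z.1) := by
    refine integral_congr_ae (Eventually.of_forall fun z => ?_)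
    show w z ^ 3 * ψ z.1 = w z * (w z * w z * ψ z.1)
    ring
  rw [e]
  refine E.trans ?_
  nlinarith [mul_le_mul_of_nonneg_left D (l2_nonneg w)]

end Sobolev


/-! ### The virial identity at a fixed time and the sign of its main part. -/

section Energy

/-- Integrable functions of integral zero. -/
def ZeroInt (g : Cyl → ℝ) : Prop := Integrable g ∧ ∫ z, g z = 0

theorem ZeroInt.add {f g : Cyl → ℝ} (hf : ZeroInt f) (hg : ZeroInt g) :
    ZeroInt (fun z => f z + g z) :=
  ⟨hf.1.add hg.1, by rw [integral_add hf.1 hg.1, hf.2, hg.2, add_zero]⟩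

theorem ZeroInt.const_mul {f : Cyl → ℝ} (c : ℝ) (hf : ZeroInt f) : ZeroInt (fun z => c * f z) :=
  ⟨hf.1.const_mul c, by rw [integral_const_mul, hf.2, mul_zero]⟩

theorem zeroInt_dx_mul {A A' B B' : Cyl → ℝ} (hA : Nice A) (hA' : Nice A') (hB : Nice B)
    (hB' : Nice B') (dA : HasDx A A') (dB : HasDx B B') :
    ZeroInt (fun z => A' z * B z + A z * B' z) :=
  have h := (hA'.integrable_mul hB).add (hA.integrable_mul hB')
  ⟨h, integral_dx_eq_zero (dA.mul dB) (hA.integrable_mul hB) h⟩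

theorem zeroInt_dy_mul {A A' B B' : Cyl → ℝ} (hA : Nice A) (hA' : Nice A') (hB : Nice B)
    (hB' : Nice B') (dA : HasDy A A') (dB : HasDy B B') :
    ZeroInt (fun z => A' z * B z + A z * B' z) :=
  have h := (hA'.integrable_mul hB).add (hA.integrable_mul hB')
  ⟨h, integral_dy_eq_zero (dA.mul dB) h
    ((hA'.cont.mul hB.cont).add (hA.cont.mul hB'.cont))⟩

/-- A weight function with three bounded continuous derivatives. -/
structure Weight (X X₁ X₂ X₃ : ℝ → ℝ) : Prop where
  d₀ : ∀ x, HasDerivAt X (X₁ x) x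
  d₁ : ∀ x, HasDerivAt X₁ (X₂ x) x
  d₂ : ∀ x, HasDerivAt X₂ (X₃ x) x
  b₀ : ∃ C, ∀ x, |X x| ≤ C
  b₁ : ∃ C, ∀ x, |X₁ x| ≤ C
  b₂ : ∃ C, ∀ x, |X₂ x| ≤ C
  b₃ : ∃ C, ∀ x, |X₃ x| ≤ C
  c₃ : Continuous X₃

theorem continuous_of_hasDerivAt {X X' : ℝ → ℝ} (h : ∀ x, HasDerivAt X (X' x) x) :
    Continuous X := continuous_iff_continuousAt.2 fun x => (h x).continuousAt

theorem Weight.bdd₀ {X X₁ X₂ X₃ : ℝ → ℝ} (h : Weight X X₁ X₂ X₃) : BddCont (fun z => X z.1) :=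
  bddCont_fst (continuous_of_hasDerivAt h.d₀) h.b₀

theorem Weight.bdd₁ {X X₁ X₂ X₃ : ℝ → ℝ} (h : Weight X X₁ X₂ X₃) : BddCont (fun z => X₁ z.1) :=
  bddCont_fst (continuous_of_hasDerivAt h.d₁) h.b₁

theorem Weight.bdd₂ {X X₁ X₂ X₃ : ℝ → ℝ} (h : Weight X X₁ X₂ X₃) : BddCont (fun z => X₂ z.1) :=
  bddCont_fst (continuous_of_hasDerivAt h.d₂) h.b₂

theorem Weight.bdd₃ {X X₁ X₂ X₃ : ℝ → ℝ} (h : Weight X X₁ X₂ X₃) : BddCont (fun z => X₃ z.1) :=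
  bddCont_fst h.c₃ h.b₃

theorem Weight.translate {X X₁ X₂ X₃ : ℝ → ℝ} (h : Weight X X₁ X₂ X₃) (a : ℝ) :
    Weight (fun x => X (x + a)) (fun x => X₁ (x + a)) (fun x => X₂ (x + a))
      (fun x => X₃ (x + a)) where
  d₀ x := (h.d₀ (x + a)).comp_add_const x a
  d₁ x := (h.d₁ (x + a)).comp_add_const x a
  d₂ x := (h.d₂ (x + a)).comp_add_const x a
  b₀ := h.b₀.imp fun _ hC _ => hC _
  b₁ := h.b₁.imp fun _ hC _ => hC _
  b₂ := h.b₂.imp fun _ hC _ => hC _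
  b₃ := h.b₃.imp fun _ hC _ => hC _
  c₃ := h.c₃.comp (continuous_add_const a)

/-- The coercive part of the virial identity with weight `X` (with `X₁ = X'`, `X₃ = X'''`)
moving at speed `c`. -/
def virialMain (c : ℝ) (X₁ X₃ : ℝ → ℝ) (w wx v : Cyl → ℝ) : ℝ :=
  ∫ z, (-(X₁ z.1 * (c * w z ^ 2 + 3 * wx z ^ 2 + 3 * v z ^ 2)) + w z ^ 2 * X₃ z.1
    + 4 * (w z ^ 3 * X₁ z.1))

variable {w wx wxx wxxx wy v vy q qx : Cyl → ℝ} {X X₁ X₂ X₃ : ℝ → ℝ}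

theorem integrable_virialMain (c : ℝ) (hw : Nice w) (hwx : Nice wx) (hv : Nice v)
    (hX : Weight X X₁ X₂ X₃) :
    Integrable (fun z => -(X₁ z.1 * (c * w z ^ 2 + 3 * wx z ^ 2 + 3 * v z ^ 2))
      + w z ^ 2 * X₃ z.1 + 4 * (w z ^ 3 * X₁ z.1)) := by
  have i1 := (hw.integrable_mul_bdd hw hX.bdd₁).const_mul (-c)
  have i2 := (hwx.integrable_mul_bdd hwx hX.bdd₁).const_mul (-3)
  have i3 := (hv.integrable_mul_bdd hv hX.bdd₁).const_mul (-3)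
  have i4 := hw.integrable_mul_bdd hw hX.bdd₃
  have i5 := ((hw.mul hw).integrable_mul_bdd hw hX.bdd₁).const_mul 4
  refine ((((i1.add i2).add i3).add i4).add i5).congr (Eventually.of_forall fun z => ?_)
  simp only [Pi.add_apply]
  ring

theorem integrable_virial (c : ℝ) (hw : Nice w) (hwxxx : Nice wxxx) (hqx : Nice qx)
    (hvy : Nice vy) (hX : Weight X X₁ X₂ X₃) :
    Integrable (fun z => 2 * w z * (-(wxxx z + 3 * qx z + 3 * vy z)) * X z.1
      - c * w z ^ 2 * X₁ z.1) := by
  have hN : Nice (fun z => (wxxx z + 3 * qx z + 3 * vy z) * X z.1) :=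
    ((hwxxx.add (hqx.const_mul 3)).add (hvy.const_mul 3)).mul_bdd hX.bdd₀
  refine (((hw.integrable_mul hN).const_mul (-2)).add
    ((hw.integrable_mul_bdd hw hX.bdd₁).const_mul (-c))).congr (Eventually.of_forall fun z => ?_)
  simp only [Pi.add_apply]
  ring

/-- The virial identity at a fixed time. -/
theorem virial_identity (c : ℝ) (hw : Nice w) (hwx : Nice wx) (hwxx : Nice wxx)
    (hwxxx : Nice wxxx) (hwy : Nice wy) (hv : Nice v) (hvy : Nice vy) (hq : Nice q) (hqx : Nice qx)
    (d1 : HasDx w wx) (d2 : HasDx wx wxx) (d3 : HasDx wxx wxxx) (d4 : HasDy w wy)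
    (d5 : HasDx v wy) (d6 : HasDy v vy) (d7 : HasDx q qx) (hX : Weight X X₁ X₂ X₃) :
    ∫ z, (2 * w z * (-(wxxx z + 3 * qx z + 3 * vy z)) * X z.1 - c * w z ^ 2 * X₁ z.1) =
      virialMain c X₁ X₃ w wx v
        + 6 * ∫ z, (wx z * X z.1 + w z * X₁ z.1) * (q z - w z ^ 2) := by
  have x0 := hasDx_fst hX.d₀
  have x1 := hasDx_fst hX.d₁
  have x2 := hasDx_fst hX.d₂
  have y0 := hasDy_fst X
  have b0 := hX.bdd₀
  have b1 := hX.bdd₁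
  have b2 := hX.bdd₂
  have b3 := hX.bdd₃
  have bz : BddCont (fun _ : Cyl => (0 : ℝ)) := ⟨continuous_const, 0, by simp⟩
  have z1 := zeroInt_dx_mul hw hwx (hwxx.mul_bdd b0)
    ((hwxxx.mul_bdd b0).add (hwxx.mul_bdd b1)) d1 (d3.mul x0)
  have z2 := zeroInt_dx_mul hwx hwxx (hwx.mul_bdd b0)
    ((hwxx.mul_bdd b0).add (hwx.mul_bdd b1)) d2 (d2.mul x0)
  have z3 := zeroInt_dx_mul hw hwx (hwx.mul_bdd b1)
    ((hwxx.mul_bdd b1).add (hwx.mul_bdd b2)) d1 (d2.mul x1)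
  have z4 := zeroInt_dx_mul hw hwx (hw.mul_bdd b2)
    ((hwx.mul_bdd b2).add (hw.mul_bdd b3)) d1 (d1.mul x2)
  have z5 := zeroInt_dx_mul hw hwx (hq.mul_bdd b0)
    ((hqx.mul_bdd b0).add (hq.mul_bdd b1)) d1 (d7.mul x0)
  have z6 := zeroInt_dx_mul hv hwy (hv.mul_bdd b0)
    ((hwy.mul_bdd b0).add (hv.mul_bdd b1)) d5 (d5.mul x0)
  have z7 := zeroInt_dx_mul (hw.mul hw) ((hwx.mul hw).add (hw.mul hwx)) (hw.mul_bdd b0)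
    ((hwx.mul_bdd b0).add (hw.mul_bdd b1)) (d1.mul d1) (d1.mul x0)
  have z8 := zeroInt_dy_mul hw hwy (hv.mul_bdd b0)
    ((hvy.mul_bdd b0).add (hv.mul_bdd bz)) d4 (d6.mul y0)
  -- The two integrands differ by the exact derivative ∂_x[-2w w_xx X + w_x² X + 2w w_x X' - w² X''
  -- - 6wqX + 3v²X + 2w³X] + ∂_y[-6wvX]. The term in v² arises from w_y v = v_x v.
  have z := ((((((z1.const_mul (-2)).add z2).add (z3.const_mul 2)).add (z4.const_mul (-1))).add
    (z5.const_mul (-6))).add (z6.const_mul 3)).add ((z7.const_mul 2).add (z8.const_mul (-6)))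
  have im := integrable_virialMain c hw hwx hv hX
  have ie : Integrable (fun z => 6 * ((wx z * X z.1 + w z * X₁ z.1) * (q z - w z ^ 2))) := by
    have hN : Nice (fun z => q z + (-1) * (w z * w z)) := hq.add ((hw.mul hw).const_mul (-1))
    refine ((((hwx.mul_bdd b0).add (hw.mul_bdd b1)).integrable_mul hN).const_mul 6).congr
      (Eventually.of_forall fun z => ?_)
    simp only
    ring
  rw [virialMain, ← integral_const_mul, ← integral_add im ie]
  refine sub_eq_zero.1 ((integral_sub (integrable_virial c hw hwxxx hqx hvy hX)
    (im.add ie)).symm.trans ?_)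
  rw [← z.2]
  refine integral_congr_ae (Eventually.of_forall fun z => ?_)
  simp only [Pi.add_apply]
  ring

theorem abs_virial_error_le (hw : Nice w) (hwx : Nice wx) (hq : MemLp q 2) {C : ℝ} (hC : 0 ≤ C)
    (h0 : ∀ x, |X x| ≤ C) (h1 : ∀ x, |X₁ x| ≤ C) (hX : Weight X X₁ X₂ X₃) :
    |∫ z, (wx z * X z.1 + w z * X₁ z.1) * (q z - w z ^ 2)| ≤
      C * (l2 wx + l2 w) * l2 (fun z => q z - w z ^ 2) := by
  have hm : MemLp (fun z => q z - w z ^ 2) 2 := by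
    have : MemLp (fun z => w z ^ 2) 2 := by simpa only [sq] using (hw.mul hw).memLp
    exact hq.sub this
  refine (abs_integral_mul_le ((hwx.mul_bdd hX.bdd₀).add (hw.mul_bdd hX.bdd₁)).memLp hm).trans ?_
  refine mul_le_mul_of_nonneg_right ?_ (l2_nonneg _)
  refine (l2_add_le (hwx.mul_bdd hX.bdd₀).memLp (hw.mul_bdd hX.bdd₁).memLp).trans ?_
  have e1 := l2_bdd_mul_le hC (Eventually.of_forall fun z : Cyl => h0 z.1) hwx.memLp
  have e2 := l2_bdd_mul_le hC (Eventually.of_forall fun z : Cyl => h1 z.1) hw.memLp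
  simp only [mul_comm (wx _), mul_comm (w _)]
  linarith

/-- The cubic estimate with ψ = X' gives 4|∫ w³X'| ≤ 12η Q. The two numerical hypotheses say that
the negative quadratic terms, after paying `a` for X''', still dominate 12η Q. -/
theorem virialMain_nonpos {c a η : ℝ} (hw : Nice w) (hwx : Nice wx) (hwy : Nice wy)
    (hv : Nice v) (d1 : HasDx w wx) (d2 : HasDy w wy) (d3 : HasDx v wy)
    (hX : Weight X X₁ X₂ X₃) (h1 : ∀ x, 0 ≤ X₁ x) (h2 : ∀ x, |X₂ x| ≤ X₁ x)
    (h3 : ∀ x, |X₃ x| ≤ a * X₁ x) (hη : l2 w ≤ η) (hc : 12 * η + a ≤ c) (hη3 : 12 * η ≤ 3) :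
    virialMain c X₁ X₃ w wx v ≤ 0 := by
  have hcube := abs_integral_cube_le hw hwx hwy hv d1 d2 d3 hX.d₁ h1 h2 hX.bdd₁ hX.bdd₂
  set Q := ∫ z, X₁ z.1 * (w z ^ 2 + wx z ^ 2 + v z ^ 2) with hQ
  have hQi : Integrable (fun z => X₁ z.1 * (w z ^ 2 + wx z ^ 2 + v z ^ 2)) := by
    have := ((hw.integrable_mul_bdd hw hX.bdd₁).add (hwx.integrable_mul_bdd hwx hX.bdd₁)).add
      (hv.integrable_mul_bdd hv hX.bdd₁)
    refine this.congr (Eventually.of_forall fun z => ?_)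
    simp only [Pi.add_apply]; ring
  have hQ0 : 0 ≤ Q := integral_nonneg fun z => mul_nonneg (h1 _) (by positivity)
  have i5 : Integrable (fun z => w z ^ 3 * X₁ z.1) := by
    refine ((hw.mul hw).integrable_mul_bdd hw hX.bdd₁).congr (Eventually.of_forall fun z => ?_)
    simp only; ring
  have hle : virialMain c X₁ X₃ w wx v ≤ ∫ z, (-(12 * η) *
      (X₁ z.1 * (w z ^ 2 + wx z ^ 2 + v z ^ 2)) + 4 * (w z ^ 3 * X₁ z.1)) := by
    refine integral_mono (integrable_virialMain c hw hwx hv hX)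
      ((hQi.const_mul _).add (i5.const_mul 4)) fun z => ?_
    have p := h1 z.1
    have m1 := mul_le_mul_of_nonneg_right (abs_le.1 (h3 z.1)).2 (sq_nonneg (w z))
    have m2 := mul_nonneg (mul_nonneg p (sq_nonneg (w z))) (sub_nonneg.2 hc)
    have m3 := mul_nonneg (mul_nonneg p (sq_nonneg (wx z))) (sub_nonneg.2 hη3)
    have m4 := mul_nonneg (mul_nonneg p (sq_nonneg (v z))) (sub_nonneg.2 hη3)
    simp only
    nlinarith
  rw [integral_add (hQi.const_mul _) (i5.const_mul 4), integral_const_mul, integral_const_mul,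
    ← hQ] at hle
  have := (abs_le.1 hcube).2
  have := mul_le_mul_of_nonneg_right hη hQ0
  nlinarith

end Energy


/-! ### Kernels `K` for which convolution with `∂ₓK` approximates the identity on `L²`. -/

section Kernels

theorem exists_primitive {ρ : ℝ → ℝ} (hρ : ContDiff ℝ ∞ ρ) (hc : HasCompactSupport ρ)
    (h0 : ∫ x, ρ x = 0) :
    ∃ H : ℝ → ℝ, ContDiff ℝ ∞ H ∧ HasCompactSupport H ∧ ∀ x, HasDerivAt H (ρ x) x := by
  obtain ⟨R, hR⟩ := hc.isCompact.isBounded.subset_closedBall (0 : ℝ)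
  have hz : ∀ x, x ∉ Set.Icc (-R) R → ρ x = 0 := by
    intro x hx
    by_contra hne
    apply hx
    have := hR (subset_tsupport _ hne)
    rwa [Real.closedBall_eq_Icc, zero_sub, zero_add] at this
  have hd : ∀ x, HasDerivAt (fun x => ∫ t in (-R)..x, ρ t) (ρ x) x := fun x =>
    (hρ.continuous.integral_hasStrictDerivAt (-R) x).hasDerivAt
  refine ⟨fun x => ∫ t in (-R)..x, ρ t, ?_, ?_, hd⟩
  · rw [contDiff_infty_iff_deriv]
    refine ⟨fun x => (hd x).differentiableAt, ?_⟩
    rwa [show deriv (fun x => ∫ t in (-R)..x, ρ t) = ρ from funext fun x => (hd x).deriv]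
  · refine HasCompactSupport.of_support_subset_isCompact (isCompact_Icc (a := -R) (b := R)) ?_
    intro x hx
    by_contra hn
    apply hx
    rw [Set.mem_Icc, not_and_or, not_le, not_le] at hn
    rcases hn with hn | hn
    · show ∫ t in (-R)..x, ρ t = 0
      rw [intervalIntegral.integral_symm, neg_eq_zero]
      refine intervalIntegral.integral_zero_ae ?_
      filter_upwards [Measure.ae_ne volume (-R)] with t ht hm
      rw [Set.uIoc_of_le hn.le] at hm
      exact hz t fun h => ht (le_antisymm hm.2 h.1)
    · show ∫ t in (-R)..x, ρ t = 0
      rcases le_or_gt (-R) x with hle | hlt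
      · rw [intervalIntegral.integral_of_le hle, ← h0]
        refine setIntegral_eq_integral_of_ae_compl_eq_zero ?_
        filter_upwards [Measure.ae_ne volume (-R)] with t ht hm
        refine hz t fun h => hm ⟨lt_of_le_of_ne h.1 (Ne.symm ht), h.2.trans hn.le⟩
      · rw [intervalIntegral.integral_symm, neg_eq_zero]
        refine intervalIntegral.integral_zero_ae (Eventually.of_forall fun t hm => ?_)
        rw [Set.uIoc_of_le hlt.le] at hm
        exact hz t fun h => absurd (h.2.trans_lt hn) (not_lt.2 hm.1.le)

/-- The cosine on the torus. -/
def cosT : Torus → ℝ := Real.cos_periodic.lift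

theorem cosT_coe (s : ℝ) : cosT (s : Torus) = Real.cos s := Real.cos_periodic.lift_coe s

theorem continuous_cosT : Continuous cosT := by
  have h1 : IsOpenQuotientMap (fun y : ℝ => (y : Torus)) := QuotientAddGroup.isOpenQuotientMap_mk
  refine (h1.isQuotientMap.continuous_iff (g := cosT)).2 ?_
  have : cosT ∘ (fun y : ℝ => (y : Torus)) = Real.cos := funext cosT_coe
  rw [this]
  exact Real.continuous_cos

theorem one_sub_cosT_nonneg (y : Torus) : 0 ≤ 1 - cosT y := by
  obtain ⟨s, rfl⟩ := exists_lift y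
  rw [cosT_coe]
  linarith [Real.cos_le_one s]

theorem eq_zero_of_cosT_eq_one {y : Torus} (h : cosT y = 1) : y = 0 := by
  obtain ⟨s, rfl⟩ := exists_lift y
  rw [cosT_coe, Real.cos_eq_one_iff] at h
  obtain ⟨n, hn⟩ := h
  rw [← hn, AddCircle.coe_eq_zero_iff]
  exact ⟨n, by simp⟩

/-- By compactness 1 - cos has a positive minimum off a neighbourhood of 0. Bumps on the torus can
then be built as functions of 1 - cos, which makes periodicity and smoothness of the lift immediate.
-/
theorem exists_forall_one_sub_cosT_lt {U : Set Torus} (hU : U ∈ 𝓝 (0 : Torus)) :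
    ∃ r > 0, ∀ y, 1 - cosT y < r → y ∈ U := by
  obtain ⟨W, hWU, hW, h0⟩ := mem_nhds_iff.1 hU
  rcases (Wᶜ).eq_empty_or_nonempty with he | hne
  · exact ⟨1, one_pos, fun y _ => hWU (by
      have : y ∉ Wᶜ := by rw [he]; exact Set.notMem_empty y
      exact Set.notMem_compl_iff.1 this)⟩
  · obtain ⟨y₀, hy₀, hmin⟩ := hW.isClosed_compl.isCompact.exists_isMinOn hne
      (f := fun y => 1 - cosT y) (continuous_const.sub continuous_cosT).continuousOn
    refine ⟨1 - cosT y₀, ?_, fun y hy => ?_⟩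
    · refine lt_of_le_of_ne (one_sub_cosT_nonneg y₀) fun h => hy₀ ?_
      rwa [eq_zero_of_cosT_eq_one (by linarith : cosT y₀ = 1)]
    · by_contra hn
      have : y ∈ Wᶜ := fun h => hn (hWU h)
      exact absurd hy (not_lt.2 (hmin this))

/-- Smooth bumps of integral one on the torus, with small support. -/
theorem exists_torus_bump {U : Set Torus} (hU : U ∈ 𝓝 (0 : Torus)) :
    ∃ m : Torus → ℝ, ContDiff ℝ ∞ (fun s : ℝ => m (s : Torus)) ∧ Continuous m ∧ (∀ y, 0 ≤ m y) ∧
      ∫ y, m y = 1 ∧ Function.support m ⊆ U := by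
  obtain ⟨r, hr, hrU⟩ := exists_forall_one_sub_cosT_lt hU
  let b : ContDiffBump (0 : ℝ) := ⟨r / 2, r, by positivity, by linarith⟩
  set m₀ : Torus → ℝ := fun y => b (1 - cosT y) with hm₀
  have hc : Continuous m₀ := b.continuous.comp (continuous_const.sub continuous_cosT)
  have hpos : 0 < ∫ y, m₀ y := by
    refine hc.integral_pos_of_hasCompactSupport_nonneg_nonzero
      (HasCompactSupport.of_compactSpace _) (fun y => b.nonneg) (x := 0) ?_
    have : cosT 0 = 1 := by simpa using cosT_coe 0
    simp only [hm₀, this, sub_self]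
    rw [b.one_of_mem_closedBall]
    · exact one_ne_zero
    · exact Metric.mem_closedBall_self (by positivity)
  refine ⟨fun y => (∫ y, m₀ y)⁻¹ * m₀ y, ?_, continuous_const.mul hc,
    fun y => mul_nonneg (inv_nonneg.2 hpos.le) b.nonneg, ?_, ?_⟩
  · refine contDiff_const.mul ?_
    have : (fun s : ℝ => m₀ (s : Torus)) = fun s => b (1 - Real.cos s) := by
      funext s; simp only [hm₀, cosT_coe]
    rw [this]
    exact b.contDiff.comp (contDiff_const.sub Real.contDiff_cos)
  · rw [integral_const_mul, inv_mul_cancel₀ hpos.ne']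
  · intro y hy
    apply hrU
    have h1 : b (1 - cosT y) ≠ 0 := right_ne_zero_of_mul hy
    have h2 : (1 - cosT y) ∈ Function.support b := h1
    rw [b.support_eq, Metric.mem_ball, dist_zero_right] at h2
    exact (le_abs_self _).trans_lt h2

theorem isTest_mul {a : ℝ → ℝ} {m : Torus → ℝ} (ha : ContDiff ℝ ∞ a) (hc : HasCompactSupport a)
    (hm : ContDiff ℝ ∞ (fun s : ℝ => m (s : Torus))) : IsTest (fun z => a z.1 * m z.2) where
  smooth := (ha.comp contDiff_fst).mul (hm.comp contDiff_snd)
  compact_support := by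
    refine HasCompactSupport.of_support_subset_isCompact
      (hc.isCompact.prod (isCompact_univ (X := Torus))) ?_
    intro z hz
    exact ⟨subset_tsupport _ (left_ne_zero_of_mul hz), Set.mem_univ _⟩

/-- `K` is a compactly supported kernel with `∂ₓ K = g - G`, where `g` and `G` are probability
densities, `g` is supported in `V` and `G ≤ η`. -/
structure IsKernel (V : Set Cyl) (η : ℝ) (K g G : Cyl → ℝ) : Prop where
  testK : IsTest K
  testg : IsTest g
  testG : IsTest G
  dx_eq : dx K = fun z => g z - G z
  g_nonneg : ∀ z, 0 ≤ g z
  G_nonneg : ∀ z, 0 ≤ G z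
  integral_g : ∫ z, g z = 1
  integral_G : ∫ z, G z = 1
  support_g : Function.support g ⊆ V
  G_le : ∀ z, G z ≤ η

theorem exists_isKernel {V : Set Cyl} (hV : V ∈ 𝓝 (0 : Cyl)) {η : ℝ} (hη : 0 < η) :
    ∃ K g G, IsKernel V η K g G := by
  obtain ⟨U₁, hU₁, U₂, hU₂, hsub⟩ := mem_nhds_prod_iff.1 hV
  obtain ⟨m, hms, hmc, hm0, hm1, hmU⟩ := exists_torus_bump hU₂
  obtain ⟨M, hM⟩ := (HasCompactSupport.of_compactSpace m).exists_bound_of_continuous hmc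
  have hM0 : 0 ≤ M := (norm_nonneg _).trans (hM 0)
  obtain ⟨r, hr, hrU⟩ := Metric.mem_nhds_iff.1 hU₁
  let a : ContDiffBump (0 : ℝ) := ⟨r / 2, r, by positivity, by linarith⟩
  -- The wide bump has height at most 1/(2R), so `G` is at most M/(2R), which is at most `η` for
  -- this radius.
  let R : ℝ := M / (2 * η) + 1
  have hR : 0 < R := by positivity
  let b : ContDiffBump (0 : ℝ) := ⟨R, R + 1, hR, by linarith⟩
  have ia : Integrable (a.normed volume) := a.integrable_normed
  have ib : Integrable (b.normed volume) := b.integrable_normed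
  -- The narrow and the wide bump have the same mass, so their difference has a compactly supported
  -- primitive in `x`.
  obtain ⟨H, hH, hHc, hHd⟩ := exists_primitive
    (ρ := fun x => a.normed volume x - b.normed volume x)
    (a.contDiff_normed.sub b.contDiff_normed)
    (a.hasCompactSupport_normed.sub b.hasCompactSupport_normed)
    (by rw [integral_sub ia ib, a.integral_normed, b.integral_normed, sub_self])
  have tK : IsTest (fun z => H z.1 * m z.2) := isTest_mul hH hHc hms
  have ip : ∀ c : ContDiffBump (0 : ℝ), ∫ z : Cyl, c.normed volume z.1 * m z.2 = 1 := by
    intro c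
    have := integral_prod_mul (μ := (volume : Measure ℝ)) (ν := (volume : Measure Torus))
      (c.normed volume) m
    rw [c.integral_normed, hm1, mul_one] at this
    exact this
  refine ⟨fun z => H z.1 * m z.2, fun z => a.normed volume z.1 * m z.2,
    fun z => b.normed volume z.1 * m z.2, tK,
    isTest_mul a.contDiff_normed a.hasCompactSupport_normed hms,
    isTest_mul b.contDiff_normed b.hasCompactSupport_normed hms, ?_,
    fun z => mul_nonneg (a.nonneg_normed _) (hm0 _),
    fun z => mul_nonneg (b.nonneg_normed _) (hm0 _), ip a, ip b, ?_, ?_⟩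
  · refine HasDx.dx_eq fun x y => ?_
    have := (hHd x).mul_const (m y)
    rw [sub_mul] at this
    exact this
  · intro z hz
    refine hsub ⟨?_, hmU (right_ne_zero_of_mul hz)⟩
    have h1 : z.1 ∈ Function.support (a.normed volume) := left_ne_zero_of_mul hz
    rw [a.support_normed_eq] at h1
    exact hrU h1
  · intro z
    have h1 : b.normed volume z.1 ≤ 1 / (2 * R) := by
      have := b.normed_le_div_measure_closedBall_rIn volume z.1
      rwa [measureReal_def, Real.volume_closedBall, ENNReal.toReal_ofReal (by positivity)] at this
    calc b.normed volume z.1 * m z.2 ≤ 1 / (2 * R) * M :=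
          mul_le_mul h1 ((le_abs_self _).trans (hM _)) (hm0 _) (by positivity)
      _ ≤ η := by
          rw [one_div, inv_mul_le_iff₀ (by positivity)]
          have : 2 * η * R = M + 2 * η := by
            simp only [R]; field_simp
          nlinarith

theorem integral_abs_of_nonneg {g : Cyl → ℝ} (h : ∀ z, 0 ≤ g z) : ∫ z, |g z| = ∫ z, g z :=
  integral_congr_ae (Eventually.of_forall fun z => abs_of_nonneg (h z))

theorem IsKernel.integral_abs_le {V : Set Cyl} {η : ℝ} {K g G : Cyl → ℝ} (h : IsKernel V η K g G) :
    ∫ z, |dx K z| ≤ 2 := by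
  rw [h.dx_eq]
  have : ∫ z, |g z - G z| ≤ ∫ z, (g z + G z) := by
    refine integral_mono (h.testg.integrable.sub h.testG.integrable).abs
      (h.testg.integrable.add h.testG.integrable) fun z => ?_
    show |_| ≤ _
    rw [abs_le]
    constructor <;> linarith [h.g_nonneg z, h.G_nonneg z]
  rw [integral_add h.testg.integrable h.testG.integrable, h.integral_g, h.integral_G] at this
  linarith

theorem IsKernel.l2_conv_le {V : Set Cyl} {η : ℝ} {K g G : Cyl → ℝ} (h : IsKernel V η K g G)
    {f : Cyl → ℝ} (hf : MemLp f 2) : l2 (conv (dx K) f) ≤ 2 * l2 f :=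
  (KP.l2_conv_le h.testK.dx.continuous h.testK.dx.compact_support hf).trans
    (mul_le_mul_of_nonneg_right h.integral_abs_le (l2_nonneg f))

theorem l2_sq_le_of_bound {f : Cyl → ℝ} (hf : MemLp f 2) (hi : Integrable f) {B A : ℝ}
    (hB : ∀ z, |f z| ≤ B) (hB0 : 0 ≤ B) (hA : ∫ z, |f z| ≤ A) : l2 f ^ 2 ≤ B * A := by
  rw [l2_sq hf]
  have : ∫ z, f z ^ 2 ≤ ∫ z, B * |f z| := by
    refine integral_mono (integrable_sq hf) (hi.abs.const_mul B) fun z => ?_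
    show f z ^ 2 ≤ B * |f z|
    rw [← sq_abs, sq]
    exact mul_le_mul_of_nonneg_right (hB z) (abs_nonneg _)
  rw [integral_const_mul] at this
  exact this.trans (mul_le_mul_of_nonneg_left hA hB0)

theorem abs_conv_sub_le {g f : Cyl → ℝ} (hg : IsTest g) (hg0 : ∀ z, 0 ≤ g z)
    (hg1 : ∫ z, g z = 1) (hf : MemLp f 2) {δ η : ℝ} (hsupp : Function.support g ⊆ Metric.ball 0 δ)
    (huc : ∀ a b, dist a b < δ → dist (f a) (f b) < η) (z : Cyl) :
    |conv g f z - f z| ≤ η := by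
  have e1 : ∫ z', g (z - z') = 1 := by rw [integral_sub_left_eq_self g volume z, hg1]
  have ig : Integrable (fun z' => g (z - z')) := hg.integrable.comp_sub_left z
  have e2 : conv g f z - f z = ∫ z', (f z' * g (z - z') - f z * g (z - z')) := by
    rw [integral_sub (integrable_conv (hg.memLp 2) hf z) (ig.const_mul _), integral_const_mul, e1,
      mul_one]
    rfl
  have e3 : η = ∫ z', η * g (z - z') := by rw [integral_const_mul, e1, mul_one]
  rw [e2, e3]
  refine abs_integral_le_integral_abs.trans (integral_mono
    ((integrable_conv (hg.memLp 2) hf z).sub (ig.const_mul _)).abs (ig.const_mul _) fun z' => ?_)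
  show |f z' * g (z - z') - f z * g (z - z')| ≤ η * g (z - z')
  rw [← sub_mul, abs_mul, abs_of_nonneg (hg0 _)]
  by_cases h : g (z - z') = 0
  · simp [h]
  · refine mul_le_mul_of_nonneg_right ?_ (hg0 _)
    have h1 := hsupp (Function.mem_support.2 h)
    rw [Metric.mem_ball, dist_zero_right, ← dist_eq_norm, dist_comm] at h1
    exact (huc _ _ h1).le

/-- Both pieces are estimated through ‖h‖₂² ≤ ‖h‖_∞ ‖h‖₁ with bounded `L¹` norms: g ∗ f - f is
uniformly small by uniform continuity, and G ∗ f because `G` is uniformly small. -/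
theorem exists_l2_conv_sub_le_of_compact {f : Cyl → ℝ} (hf : Continuous f)
    (hc : HasCompactSupport f) {ε : ℝ} (hε : 0 < ε) :
    ∃ V ∈ 𝓝 (0 : Cyl), ∃ η₀ > 0, ∀ η ≤ η₀, ∀ K g G, IsKernel V η K g G →
      l2 (fun z => conv (dx K) f z - f z) ≤ ε := by
  have hfm : MemLp f 2 := hf.memLp_of_hasCompactSupport hc
  have hfi : Integrable f := hf.integrable_of_hasCompactSupport hc
  set A := ∫ z, |f z| with hA
  have hA0 : 0 ≤ A := integral_nonneg fun _ => abs_nonneg _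
  set τ := (ε / 2) ^ 2 / (2 * A + 1) with hτ
  have hτ0 : 0 < τ := by positivity
  have hτ1 : τ * (2 * A) ≤ (ε / 2) ^ 2 := by
    rw [hτ, div_mul_eq_mul_div, div_le_iff₀ (by positivity)]
    nlinarith [sq_nonneg (ε / 2)]
  obtain ⟨δ, hδ, huc⟩ := Metric.uniformContinuous_iff.1
    (hc.uniformContinuous_of_continuous hf) τ hτ0
  set η₀ := (ε / 2) ^ 2 / (A ^ 2 + 1) with hη₀
  have hη1 : η₀ * A ^ 2 ≤ (ε / 2) ^ 2 := by
    rw [hη₀, div_mul_eq_mul_div, div_le_iff₀ (by positivity)]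
    nlinarith [sq_nonneg (ε / 2)]
  refine ⟨Metric.ball 0 δ, Metric.ball_mem_nhds _ hδ, η₀, by positivity, ?_⟩
  intro η hη K g G h
  have hη0 : 0 ≤ η := (h.G_nonneg 0).trans (h.G_le 0)
  have mg := conv_memLp h.testg.continuous h.testg.compact_support hfm
  have mG := conv_memLp h.testG.continuous h.testG.compact_support hfm
  have ig := conv_integrable h.testg.integrable hfi
  have iG := conv_integrable h.testG.integrable hfi
  have L1g : ∫ z, |conv g f z| ≤ A := by
    have := integral_abs_conv_le h.testg.integrable hfi
    rwa [integral_abs_of_nonneg h.g_nonneg, h.integral_g, mul_one] at this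
  have L1G : ∫ z, |conv G f z| ≤ A := by
    have := integral_abs_conv_le h.testG.integrable hfi
    rwa [integral_abs_of_nonneg h.G_nonneg, h.integral_G, mul_one] at this
  have p1 : l2 (fun z => conv g f z - f z) ≤ ε / 2 := by
    have L1 : ∫ z, |conv g f z - f z| ≤ 2 * A := by
      have : ∫ z, |conv g f z - f z| ≤ ∫ z, (|conv g f z| + |f z|) :=
        integral_mono (ig.sub hfi).abs (ig.abs.add hfi.abs) fun z => abs_sub _ _
      rw [integral_add ig.abs hfi.abs] at this
      linarith
    have := l2_sq_le_of_bound (mg.sub hfm) (ig.sub hfi)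
      (abs_conv_sub_le h.testg h.g_nonneg h.integral_g hfm h.support_g huc) hτ0.le L1
    exact (sq_le_sq₀ (l2_nonneg _) (by positivity)).1 (this.trans hτ1)
  have p2 : l2 (conv G f) ≤ ε / 2 := by
    have hb : ∀ z, |conv G f z| ≤ η * A := by
      intro z
      rw [hA, ← integral_const_mul]
      refine abs_integral_le_integral_abs.trans (integral_mono
        (integrable_conv (h.testG.memLp 2) hfm z).abs (hfi.abs.const_mul _) fun z' => ?_)
      show |f z' * G (z - z')| ≤ η * |f z'|
      rw [abs_mul, abs_of_nonneg (h.G_nonneg _), mul_comm]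
      exact mul_le_mul_of_nonneg_right (h.G_le _) (abs_nonneg _)
    have := l2_sq_le_of_bound mG iG hb (by positivity) L1G
    refine (sq_le_sq₀ (l2_nonneg _) (by positivity)).1 (this.trans (le_trans ?_ hη1))
    nlinarith [mul_le_mul_of_nonneg_right hη (sq_nonneg A)]
  have e : (fun z => conv (dx K) f z - f z) = fun z => (conv g f z - f z) - conv G f z := by
    rw [h.dx_eq, conv_sub_left (h.testg.memLp 2) (h.testG.memLp 2) hfm]
    funext z; ring
  rw [e]
  have := l2_sub_le (mg.sub hfm) mG
  have e3 : l2 (conv g f - f) = l2 (fun z => conv g f z - f z) := rfl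
  simp only [Pi.sub_apply] at this
  linarith

/-- Density of continuous compactly supported functions, together with the bound 2 on the `L²`
operator norm, which is uniform over kernels. -/
theorem exists_l2_conv_sub_le {f : Cyl → ℝ} (hf : MemLp f 2) {ε : ℝ} (hε : 0 < ε) :
    ∃ V ∈ 𝓝 (0 : Cyl), ∃ η₀ > 0, ∀ η ≤ η₀, ∀ K g G, IsKernel V η K g G →
      l2 (fun z => conv (dx K) f z - f z) ≤ ε := by
  obtain ⟨f₁, hc₁, hd, hf₁, hm₁⟩ := hf.exists_hasCompactSupport_eLpNorm_sub_le (by norm_num)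
    (ε := ENNReal.ofReal (ε / 4)) (by simpa using hε)
  have hd' : l2 (fun z => f z - f₁ z) ≤ ε / 4 := ENNReal.toReal_le_of_le_ofReal (by positivity) hd
  obtain ⟨V, hV, η₀, hη₀, H⟩ := exists_l2_conv_sub_le_of_compact hf₁ hc₁
    (by positivity : 0 < ε / 4)
  refine ⟨V, hV, η₀, hη₀, fun η hη K g G h => ?_⟩
  have h1 := H η hη K g G h
  have hs : MemLp (fun z => f z - f₁ z) 2 := hf.sub hm₁
  have h2 := h.l2_conv_le hs
  have c := conv_memLp h.testK.dx.continuous h.testK.dx.compact_support hs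
  have c1 := conv_memLp h.testK.dx.continuous h.testK.dx.compact_support hm₁
  have e : (fun z => conv (dx K) f z - f z) = fun z => (conv (dx K) (fun z => f z - f₁ z) z +
      (conv (dx K) f₁ z - f₁ z)) - (f z - f₁ z) := by
    rw [conv_sub_right (h.testK.dx.memLp 2) hf hm₁]
    funext z; ring
  rw [e]
  have h3 := l2_sub_le (f := fun z => conv (dx K) (fun z => f z - f₁ z) z +
      (conv (dx K) f₁ z - f₁ z)) (c.add (c1.sub hm₁)) hs
  have h4 := l2_add_le (g := fun z => conv (dx K) f₁ z - f₁ z) c (c1.sub hm₁)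
  linarith

/-- A sequence of kernels `K n` such that convolution with `∂ₓ (K n)` tends to the identity
strongly on `L²`. -/
theorem exists_kernels : ∃ K : ℕ → Cyl → ℝ, (∀ n, IsTest (K n)) ∧ (∀ n, ∫ z, |dx (K n) z| ≤ 2) ∧
    ∀ f : Cyl → ℝ, MemLp f 2 →
      Tendsto (fun n => l2 (fun z => conv (dx (K n)) f z - f z)) atTop (𝓝 0) := by
  obtain ⟨V, hV⟩ := (𝓝 (0 : Cyl)).exists_antitone_basis
  have hex := fun n : ℕ => exists_isKernel (hV.1.mem_of_mem (i := n) trivial)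
    (Nat.one_div_pos_of_nat (α := ℝ) (n := n))
  choose K g G h using hex
  refine ⟨K, fun n => (h n).testK, fun n => (h n).integral_abs_le, fun f hf => ?_⟩
  rw [Metric.tendsto_atTop]
  intro ε hε
  obtain ⟨W, hW, η₀, hη₀, H⟩ := exists_l2_conv_sub_le hf (half_pos hε)
  obtain ⟨N₁, -, hN₁⟩ := hV.1.mem_iff.1 hW
  obtain ⟨N₂, hN₂⟩ := exists_nat_one_div_lt hη₀
  refine ⟨max N₁ N₂, fun n hn => ?_⟩
  rw [Real.dist_eq, sub_zero, abs_of_nonneg (l2_nonneg _)]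
  have hk := h n
  have hk' : IsKernel W (1 / ((n : ℝ) + 1)) (K n) (g n) (G n) :=
    { hk with support_g := hk.support_g.trans ((hV.2 (le_of_max_le_left hn)).trans hN₁) }
  have hη : 1 / ((n : ℝ) + 1) ≤ η₀ :=
    (Nat.one_div_le_one_div (le_of_max_le_right hn)).trans hN₂.le
  exact (H _ hη _ _ _ hk').trans_lt (half_lt_self hε)

end Kernels


/-! ### From the distributional equation to classical derivatives in time. -/

section Time

/-- The du Bois-Reymond lemma: subtracting (∫ g) η from a test function `g`, where ∫ η = 1, makes it
the derivative of a test function. -/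
theorem eq_const_of_integral_deriv_mul_eq_zero {A : ℝ → ℝ} (hA : Continuous A)
    (h : ∀ θ : ℝ → ℝ, ContDiff ℝ ∞ θ → HasCompactSupport θ → ∫ t, deriv θ t * A t = 0) :
    ∃ C, ∀ t, A t = C := by
  let b : ContDiffBump (0 : ℝ) := ⟨1, 2, one_pos, one_lt_two⟩
  set η : ℝ → ℝ := b.normed volume with hη
  have hηs : ContDiff ℝ ∞ η := b.contDiff_normed
  have hηc : HasCompactSupport η := b.hasCompactSupport_normed
  have hηi : Integrable η := b.integrable_normed
  set C := ∫ t, η t * A t with hC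
  have hint : ∀ g : ℝ → ℝ, Continuous g → HasCompactSupport g → Integrable (fun t => g t * A t) :=
    fun g hg hc => (hg.mul hA).integrable_of_hasCompactSupport hc.mul_right
  refine ⟨C, fun t => ?_⟩
  have key : ∀ᵐ t, A t - C = 0 := by
    refine ae_eq_zero_of_integral_contDiff_smul_eq_zero
      (hA.sub continuous_const).locallyIntegrable fun g hg hc => ?_
    have hgi : Integrable g := hg.continuous.integrable_of_hasCompactSupport hc
    have hρ : ContDiff ℝ ∞ (fun t => g t - (∫ s, g s) * η t) := hg.sub (contDiff_const.mul hηs)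
    obtain ⟨θ, hθ, hθc, hθd⟩ := exists_primitive hρ
      (hc.sub (hηc.mul_left (f := fun _ => ∫ s, g s)))
      (by rw [integral_sub hgi (hηi.const_mul _), integral_const_mul, b.integral_normed]; ring)
    have h1 := h θ hθ hθc
    have h2 : ∀ t, deriv θ t * A t = g t * A t - (∫ s, g s) * (η t * A t) := fun t => by
      rw [(hθd t).deriv]; ring
    simp only [h2] at h1
    rw [integral_sub (hint g hg.continuous hc) ((hint η hηs.continuous hηc).const_mul _),
      integral_const_mul, ← hC] at h1
    have h3 : ∀ t, g t • (A t - C) = g t * A t - g t * C := fun t => by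
      rw [smul_eq_mul]; ring
    simp only [h3]
    rw [integral_sub (hint g hg.continuous hc) (hgi.mul_const _), integral_mul_const]
    exact h1
  have h1 : A =ᵐ[volume] fun _ => C := by
    filter_upwards [key] with t ht
    linarith
  exact congrFun ((hA.ae_eq_iff_eq volume continuous_const).1 h1) t

theorem hasDerivAt_of_weak {a b : ℝ → ℝ} (ha : Continuous a) (hb : Continuous b)
    (h : ∀ θ : ℝ → ℝ, ContDiff ℝ ∞ θ → HasCompactSupport θ →
      ∫ t, (deriv θ t * a t + θ t * b t) = 0) (t : ℝ) : HasDerivAt a (b t) t := by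
  have hB : ∀ x, HasDerivAt (fun x => ∫ s in (0 : ℝ)..x, b s) (b x) x := fun x =>
    (hb.integral_hasStrictDerivAt 0 x).hasDerivAt
  set B : ℝ → ℝ := fun x => ∫ s in (0 : ℝ)..x, b s with hBdef
  have hBc : Continuous B := continuous_of_hasDerivAt hB
  obtain ⟨C, hC⟩ := eq_const_of_integral_deriv_mul_eq_zero (ha.sub hBc) fun θ hθ hc => by
    have hd : ∀ x, HasDerivAt θ (deriv θ x) x := fun x =>
      ((hθ.differentiable (by simp)) x).hasDerivAt
    have hdc : Continuous (deriv θ) := hθ.continuous_deriv (by simp)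
    have i1 : Integrable (fun t => θ t * B t) :=
      (hθ.continuous.mul hBc).integrable_of_hasCompactSupport hc.mul_right
    have i2 : Integrable (fun t => deriv θ t * B t + θ t * b t) :=
      ((hdc.mul hBc).integrable_of_hasCompactSupport hc.deriv.mul_right).add
        ((hθ.continuous.mul hb).integrable_of_hasCompactSupport hc.mul_right)
    have i3 : Integrable (fun t => deriv θ t * a t + θ t * b t) :=
      ((hdc.mul ha).integrable_of_hasCompactSupport hc.deriv.mul_right).add
        ((hθ.continuous.mul hb).integrable_of_hasCompactSupport hc.mul_right)
    have z := integral_eq_zero_of_hasDerivAt_of_integrable (fun x => (hd x).mul (hB x)) i2 i1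
    have z' := h θ hθ hc
    have e : ∀ t, deriv θ t * (a - B) t =
        (deriv θ t * a t + θ t * b t) - (deriv θ t * B t + θ t * b t) := fun t => by
      simp only [Pi.sub_apply]; ring
    simp only [e]
    rw [integral_sub i3 i2, z, z', sub_zero]
  have e : a = fun x => B x + C := by
    funext x
    have := hC x
    simp only [Pi.sub_apply] at this
    linarith
  rw [e]
  exact (hB t).add_const C

theorem isSpaceTimeTest_mul {θ : ℝ → ℝ} {κ : Cyl → ℝ} (hθ : ContDiff ℝ ∞ θ)
    (hc : HasCompactSupport θ) (hκ : IsTest κ) : IsSpaceTimeTest (fun t z => θ t * κ z) where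
  smooth := (hθ.comp contDiff_fst).mul (hκ.smooth.comp contDiff_snd)
  compact_support := by
    refine HasCompactSupport.of_support_subset_isCompact
      (hc.isCompact.prod hκ.compact_support.isCompact) ?_
    intro p hp
    exact ⟨subset_tsupport _ (left_ne_zero_of_mul hp), subset_tsupport _ (right_ne_zero_of_mul hp)⟩

/-- The weak form of the equation tested with `θ(t) K(z - ·)`. -/
theorem SolvesKPII.integral_eq_zero {u : ℝ → L2} (hu : SolvesKPII u)
    (hu2 : ∀ t, MemLp (fun z => (u t z) ^ 2) 2) {K : Cyl → ℝ} (hK : IsTest K) (z : Cyl)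
    {θ : ℝ → ℝ} (hθ : ContDiff ℝ ∞ θ) (hc : HasCompactSupport θ) :
    ∫ t, (deriv θ t * conv (dx K) (u t) z + θ t *
      (-(conv (dx^[4] K) (u t) z + 3 * conv (dx^[2] K) (fun z => (u t z) ^ 2) z
        + 3 * conv (dy^[2] K) (u t) z))) = 0 := by
  have h := hu _ (isSpaceTimeTest_mul hθ hc (hK.reflect z))
  -- The single `x`-derivative paired with `∂_t` changes sign under reflection, while the even-order
  -- derivatives do not; hence the global sign.
  rw [← neg_eq_zero, ← integral_neg, ← h]
  refine integral_congr_ae (Eventually.of_forall fun t => ?_)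
  have m := Lp.memLp (u t)
  have hx2 : IsTest (dx^[2] K) := hK.dx.dx
  have hx4 : IsTest (dx^[4] K) := hK.dx.dx.dx.dx
  have hy2 : IsTest (dy^[2] K) := hK.dy.dy
  have i1 := (integrable_conv (hK.dx.memLp 2) m z).const_mul (-deriv θ t)
  have i2 := (integrable_conv (hx4.memLp 2) m z).const_mul (θ t)
  have i3 := (integrable_conv (hx2.memLp 2) (hu2 t) z).const_mul (3 * θ t)
  have i4 := (integrable_conv (hy2.memLp 2) m z).const_mul (3 * θ t)
  have e : ∀ z', (u t z' * dt (fun s => dx ((fun t z' => θ t * K (z - z')) s)) t z'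
        + u t z' * (dx^[4] ((fun t z' => θ t * K (z - z')) t)) z'
        + 3 * (u t z') ^ 2 * (dx^[2] ((fun t z' => θ t * K (z - z')) t)) z'
        + 3 * u t z' * (dy^[2] ((fun t z' => θ t * K (z - z')) t)) z') =
      (((-deriv θ t) * (u t z' * dx K (z - z')) + θ t * (u t z' * (dx^[4] K) (z - z')))
        + 3 * θ t * ((u t z') ^ 2 * (dx^[2] K) (z - z')))
        + 3 * θ t * (u t z' * (dy^[2] K) (z - z')) := by
    intro z'
    have e1 : dt (fun s => dx ((fun t z' => θ t * K (z - z')) s)) t z' =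
        -(deriv θ t * dx K (z - z')) := by
      simp only [dt, dx_const_mul, dx_reflect]
      rw [deriv_mul_const_field, mul_neg]
    rw [e1]
    simp only [iterate_dx_const_mul, iterate_dy_const_mul, iterate_dx_reflect,
      iterate_dy_reflect]
    ring
  have j2 : Integrable (fun z' => (-deriv θ t) * (u t z' * dx K (z - z'))
      + θ t * (u t z' * (dx^[4] K) (z - z'))) := i1.add i2
  have j3 : Integrable (fun z' => (-deriv θ t) * (u t z' * dx K (z - z'))
      + θ t * (u t z' * (dx^[4] K) (z - z'))
      + 3 * θ t * ((u t z') ^ 2 * (dx^[2] K) (z - z'))) := j2.add i3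
  beta_reduce
  rw [integral_congr_ae (Eventually.of_forall e), integral_add j3 i4, integral_add j2 i3,
    integral_add i1 i2]
  simp only [integral_const_mul, conv]
  ring

theorem continuous_conv_apply {u : ℝ → L2} (hu : Continuous u) {κ : Cyl → ℝ} (hκ : MemLp κ 2)
    (z : Cyl) : Continuous (fun t => conv κ (u t) z) := by
  have hm := memLp_reflect hκ z
  have e : (fun t => conv κ (u t) z) = fun t => inner ℝ (hm.toLp _) (u t) := by
    funext t
    rw [L2.inner_def]
    refine integral_congr_ae ?_
    filter_upwards [hm.coeFn_toLp] with z' hz'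
    rw [hz']
    simp
  rw [e]
  fun_prop

theorem abs_integral_sq_sub_le {f g κ : Cyl → ℝ} (hf : MemLp f 2) (hg : MemLp g 2)
    (hκ : AEStronglyMeasurable κ volume) {C : ℝ} (hC0 : 0 ≤ C) (hC : ∀ z, |κ z| ≤ C) :
    |(∫ z, f z ^ 2 * κ z) - ∫ z, g z ^ 2 * κ z| ≤
      C * l2 (fun z => f z - g z) * (l2 f + l2 g) := by
  have i : ∀ {f : Cyl → ℝ}, MemLp f 2 → Integrable (fun z => f z ^ 2 * κ z) := fun hf =>
    (integrable_sq hf).mul_bdd hκ (Eventually.of_forall hC)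
  have hs : MemLp (fun z => f z + g z) 2 := hf.add hg
  have hd : MemLp (fun z => f z - g z) 2 := hf.sub hg
  have hm : MemLp (fun z => κ z * (f z - g z)) 2 := memLp_bdd_mul hκ (Eventually.of_forall hC) hd
  have e : (∫ z, f z ^ 2 * κ z) - ∫ z, g z ^ 2 * κ z =
      ∫ z, (κ z * (f z - g z)) * (f z + g z) := by
    rw [← integral_sub (i hf) (i hg)]
    refine integral_congr_ae (Eventually.of_forall fun z => ?_)
    simp only
    ring
  rw [e]
  refine (abs_integral_mul_le hm hs).trans ?_
  exact mul_le_mul (l2_bdd_mul_le hC0 (Eventually.of_forall hC) hd) (l2_add_le hf hg)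
    (l2_nonneg _) (mul_nonneg hC0 (l2_nonneg _))

theorem l2_sub_eq_norm (f g : L2) : l2 (fun z => f z - g z) = ‖f - g‖ := by
  rw [← l2_eq_norm]
  exact l2_congr (Lp.coeFn_sub f g).symm

theorem continuous_integral_sq_mul {u : ℝ → L2} (hu : Continuous u) {κ : Cyl → ℝ}
    (hκ : AEStronglyMeasurable κ volume) {C : ℝ} (hC0 : 0 ≤ C) (hC : ∀ z, |κ z| ≤ C) :
    Continuous (fun t => ∫ z, (u t z) ^ 2 * κ z) := by
  rw [continuous_iff_continuousAt]
  intro s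
  rw [ContinuousAt, tendsto_iff_dist_tendsto_zero]
  have hlim : Tendsto (fun t => C * ‖u t - u s‖ * (‖u t‖ + ‖u s‖)) (𝓝 s) (𝓝 0) := by
    have : Continuous (fun t => C * ‖u t - u s‖ * (‖u t‖ + ‖u s‖)) := by fun_prop
    simpa using this.tendsto s
  refine squeeze_zero (fun _ => dist_nonneg) (fun t => ?_) hlim
  rw [Real.dist_eq, ← l2_sub_eq_norm, ← l2_eq_norm (u t), ← l2_eq_norm (u s)]
  exact abs_integral_sq_sub_le (Lp.memLp _) (Lp.memLp _) hκ hC0 hC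

/-- Mollifications of a solution solve the mollified equation classically in time. -/
theorem SolvesKPII.hasDerivAt_conv {u : ℝ → L2} (hu : SolvesKPII u) (huc : Continuous u)
    (hu2 : ∀ t, MemLp (fun z => (u t z) ^ 2) 2) {K : Cyl → ℝ} (hK : IsTest K) (z : Cyl) :
    Continuous (fun t => -(conv (dx^[4] K) (u t) z
      + 3 * conv (dx^[2] K) (fun z => (u t z) ^ 2) z + 3 * conv (dy^[2] K) (u t) z)) ∧
    ∀ t, HasDerivAt (fun t => conv (dx K) (u t) z)
      (-(conv (dx^[4] K) (u t) z + 3 * conv (dx^[2] K) (fun z => (u t z) ^ 2) z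
        + 3 * conv (dy^[2] K) (u t) z)) t := by
  have hx2 : IsTest (dx^[2] K) := hK.dx.dx
  have hx4 : IsTest (dx^[4] K) := hK.dx.dx.dx.dx
  have hy2 : IsTest (dy^[2] K) := hK.dy.dy
  have c1 := continuous_conv_apply huc (hK.dx.memLp 2) z
  have c2 := continuous_conv_apply huc (hx4.memLp 2) z
  have c3 := continuous_conv_apply huc (hy2.memLp 2) z
  have c4 : Continuous (fun t => conv (dx^[2] K) (fun z => (u t z) ^ 2) z) := by
    obtain ⟨C, hC⟩ := hx2.exists_bound
    exact continuous_integral_sq_mul huc (hx2.reflect z).continuous.aestronglyMeasurable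
      ((abs_nonneg _).trans (hC 0)) fun z' => hC _
  have cb : Continuous (fun t => -(conv (dx^[4] K) (u t) z
      + 3 * conv (dx^[2] K) (fun z => (u t z) ^ 2) z + 3 * conv (dy^[2] K) (u t) z)) := by
    fun_prop
  exact ⟨cb, fun t => hasDerivAt_of_weak c1 cb
    (fun θ hθ hc => hu.integral_eq_zero hu2 hK z hθ hc) t⟩

end Time


/-! ### Sup bounds, and the commutator between squaring and mollifying. -/

section Mollify

theorem conv_nice {κ f : Cyl → ℝ} (hκ : IsTest κ) (hf : MemLp f 2) : Nice (conv κ f) where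
  cont := conv_continuous hκ.continuous hκ.compact_support (hf.locallyIntegrable (by norm_num))
  bound := ⟨_, abs_conv_le_l2 (hκ.memLp 2) hf⟩
  memLp := conv_memLp hκ.continuous hκ.compact_support hf

theorem IsTest.l2_conv_le_two {k : Cyl → ℝ} (hk : IsTest k) (h2 : ∫ z, |k z| ≤ 2) {f : Cyl → ℝ}
    (hf : MemLp f 2) : l2 (conv k f) ≤ 2 * l2 f :=
  (l2_conv_le hk.continuous hk.compact_support hf).trans
    (mul_le_mul_of_nonneg_right h2 (l2_nonneg f))

/-- A bound for the supremum of a function by `L²` norms of derivatives. -/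
def supBound (f fx fy fxy : L2) : ℝ :=
  Real.sqrt (8 * (‖f‖ ^ 2 + ‖fx‖ ^ 2 + ‖fy‖ ^ 2 + ‖fxy‖ ^ 2))

theorem l2_conv_dx_le {k : Cyl → ℝ} (hk : IsTest k) (h2 : ∫ z, |k z| ≤ 2) {f fx : L2}
    (hx : HasWeakDeriv 1 0 f fx) : l2 (conv (dx k) f) ≤ 2 * ‖fx‖ := by
  have h := conv_iterate_of_hasWeakDeriv hx hk
  simp only [Function.iterate_one, Function.iterate_zero, id_eq] at h
  rw [h, ← l2_eq_norm]
  exact hk.l2_conv_le_two h2 (Lp.memLp fx)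

theorem ae_abs_conv_le_supBound {k : Cyl → ℝ} (hk : IsTest k) (h2 : ∫ z, |k z| ≤ 2)
    {f fx fy fxy : L2} (hx : HasWeakDeriv 1 0 f fx) (hy : HasWeakDeriv 0 1 f fy)
    (hxy : HasWeakDeriv 1 1 f fxy) : ∀ᵐ z, |conv k f z| ≤ supBound f fx fy fxy := by
  have m := Lp.memLp f
  have e := ae_sq_le_sobolev (conv_nice hk m) (conv_nice hk.dx m) (conv_nice hk.dy m)
    (conv_nice hk.dx.dy m) (conv_hasDx hk m) (conv_hasDy hk m) (conv_hasDy hk.dx m)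
  have b0 : l2 (conv k f) ≤ 2 * ‖f‖ := by
    rw [← l2_eq_norm]; exact hk.l2_conv_le_two h2 m
  have b1 := l2_conv_dx_le hk h2 hx
  have b2 : l2 (conv (dy k) f) ≤ 2 * ‖fy‖ := by
    have h := conv_iterate_of_hasWeakDeriv hy hk
    simp only [Function.iterate_one, Function.iterate_zero, id_eq] at h
    rw [h, ← l2_eq_norm]
    exact hk.l2_conv_le_two h2 (Lp.memLp fy)
  have b3 : l2 (conv (dy (dx k)) f) ≤ 2 * ‖fxy‖ := by
    have h := conv_iterate_of_hasWeakDeriv hxy hk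
    simp only [Function.iterate_one] at h
    rw [← hk.dx_dy_comm, h, ← l2_eq_norm]
    exact hk.l2_conv_le_two h2 (Lp.memLp fxy)
  have s0 := pow_le_pow_left₀ (l2_nonneg _) b0 2
  have s1 := pow_le_pow_left₀ (l2_nonneg _) b1 2
  have s2 := pow_le_pow_left₀ (l2_nonneg _) b2 2
  have s3 := pow_le_pow_left₀ (l2_nonneg _) b3 2
  filter_upwards [e] with z hz
  refine Real.abs_le_sqrt (hz.trans ?_)
  nlinarith

/-- A subsequence converges almost everywhere. This passes the Sobolev bound from mollifications to
the function itself. -/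
theorem ae_abs_le_of_tendsto_l2 {f : Cyl → ℝ} {g : ℕ → Cyl → ℝ} (hf : MemLp f 2)
    (hg : ∀ n, MemLp (g n) 2) (h : Tendsto (fun n => l2 (fun z => g n z - f z)) atTop (𝓝 0))
    {M : ℝ} (hM : ∀ n, ∀ᵐ z, |g n z| ≤ M) : ∀ᵐ z, |f z| ≤ M := by
  have h1 : Tendsto (fun n => eLpNorm (g n - f) 2 volume) atTop (𝓝 0) :=
    (ENNReal.tendsto_toReal_iff (fun n => ((hg n).sub hf).eLpNorm_ne_top)
      ENNReal.zero_ne_top).1 h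
  obtain ⟨ns, -, hns⟩ := (tendstoInMeasure_of_tendsto_eLpNorm (by norm_num)
    (fun n => (hg n).1) hf.1 h1).exists_seq_tendsto_ae
  filter_upwards [hns, ae_all_iff.2 hM] with z hz hMz
  exact le_of_tendsto hz.abs (Eventually.of_forall fun n => hMz _)

theorem ae_abs_le_supBound {f fx fy fxy : L2} (hx : HasWeakDeriv 1 0 f fx)
    (hy : HasWeakDeriv 0 1 f fy) (hxy : HasWeakDeriv 1 1 f fxy) :
    ∀ᵐ z, |f z| ≤ supBound f fx fy fxy := by
  obtain ⟨K, hK, h2, hlim⟩ := exists_kernels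
  have m := Lp.memLp f
  exact ae_abs_le_of_tendsto_l2 m (fun n => (conv_nice (hK n).dx m).memLp) (hlim f m)
    fun n => ae_abs_conv_le_supBound (hK n).dx (h2 n) hx hy hxy

theorem memLp_sq {f : Cyl → ℝ} (hf : MemLp f 2) {M : ℝ} (hM : ∀ᵐ z, |f z| ≤ M) :
    MemLp (fun z => f z ^ 2) 2 := by
  simpa only [sq] using memLp_bdd_mul hf.1 hM hf

theorem l2_sq_le {f : Cyl → ℝ} (hf : MemLp f 2) {M : ℝ} (hM0 : 0 ≤ M) (hM : ∀ᵐ z, |f z| ≤ M) :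
    l2 (fun z => f z ^ 2) ≤ M * l2 f := by
  simpa only [sq] using l2_bdd_mul_le hM0 hM hf

theorem l2_sq_sub_sq_le {f g : Cyl → ℝ} (hf : MemLp f 2) (hg : MemLp g 2) {M : ℝ} (hM0 : 0 ≤ M)
    (hMf : ∀ᵐ z, |f z| ≤ M) (hMg : ∀ᵐ z, |g z| ≤ M) :
    l2 (fun z => f z ^ 2 - g z ^ 2) ≤ 2 * M * l2 (fun z => f z - g z) := by
  have h : ∀ᵐ z, |f z + g z| ≤ 2 * M := by
    filter_upwards [hMf, hMg] with z h1 h2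
    linarith [abs_add_le (f z) (g z)]
  have := l2_bdd_mul_le (g := fun z => f z - g z) (by positivity) h (hf.sub hg)
  simpa only [sq_sub_sq] using this

/-- The distance between the mollified square and the square of the mollification. -/
theorem l2_conv_sq_sub_le {k f : Cyl → ℝ} (hk : IsTest k) (hf : MemLp f 2) {M : ℝ} (hM0 : 0 ≤ M)
    (hMf : ∀ᵐ z, |f z| ≤ M) (hMw : ∀ᵐ z, |conv k f z| ≤ M) :
    l2 (fun z => conv k (fun z => f z ^ 2) z - conv k f z ^ 2) ≤
      l2 (fun z => conv k (fun z => f z ^ 2) z - f z ^ 2)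
        + 2 * M * l2 (fun z => conv k f z - f z) := by
  have m2 := memLp_sq hf hMf
  have w := (conv_nice hk hf).memLp
  have w2 := memLp_sq w hMw
  have h1 := l2_sub_le (f := fun z => conv k (fun z => f z ^ 2) z - f z ^ 2)
    (g := fun z => conv k f z ^ 2 - f z ^ 2) ((conv_nice hk m2).memLp.sub m2) (w2.sub m2)
  have e : (fun z => conv k (fun z => f z ^ 2) z - conv k f z ^ 2) =
      fun z => (conv k (fun z => f z ^ 2) z - f z ^ 2) - (conv k f z ^ 2 - f z ^ 2) := by
    funext z; ring
  rw [e]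
  linarith [l2_sq_sub_sq_le w hf hM0 hMw hMf]

end Mollify

/-! ### The integrated virial inequality and its limit. -/

section Monotonicity

theorem integrableOn_prod_of_bound {Φ : ℝ → Cyl → ℝ} (hc : ∀ z, Continuous (fun t => Φ t z))
    (hm : ∀ t, StronglyMeasurable (Φ t)) (hi : ∀ t, Integrable (Φ t)) {b : ℝ → ℝ}
    (hb : Continuous b) (hbound : ∀ t, ∫ z, |Φ t z| ≤ b t) (t₁ t₂ : ℝ) :
    Integrable (Function.uncurry Φ)
      ((volume.restrict (Set.Ioc t₁ t₂)).prod (volume : Measure Cyl)) := by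
  have hsm : StronglyMeasurable (Function.uncurry Φ) :=
    stronglyMeasurable_uncurry_of_continuous_of_stronglyMeasurable hc hm
  rw [integrable_prod_iff hsm.aestronglyMeasurable]
  refine ⟨Eventually.of_forall hi, ?_⟩
  have hbi : Integrable b (volume.restrict (Set.Ioc t₁ t₂)) :=
    (hb.integrableOn_Icc (a := t₁) (b := t₂)).mono_set Set.Ioc_subset_Icc_self
  refine Integrable.mono' hbi (hsm.norm.integral_prod_right'.aestronglyMeasurable)
    (Eventually.of_forall fun t => ?_)
  rw [Real.norm_eq_abs, abs_of_nonneg (integral_nonneg fun _ => norm_nonneg _)]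
  exact hbound t

/-- The fundamental theorem of calculus at each `z`, followed by Fubini. Only a bound on ∫ |Φ| at
each time is needed, not a dominating function of `z` uniform in time. -/
theorem integral_sub_eq_integral_integral {Ψ Φ : ℝ → Cyl → ℝ}
    (hd : ∀ z t, HasDerivAt (fun t => Ψ t z) (Φ t z) t) (hc : ∀ z, Continuous (fun t => Φ t z))
    (hm : ∀ t, StronglyMeasurable (Φ t)) (hiΨ : ∀ t, Integrable (Ψ t))
    (hi : ∀ t, Integrable (Φ t)) {b : ℝ → ℝ} (hb : Continuous b)
    (hbound : ∀ t, ∫ z, |Φ t z| ≤ b t) {t₁ t₂ : ℝ} (h : t₁ ≤ t₂) :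
    IntegrableOn (fun t => ∫ z, Φ t z) (Set.Ioc t₁ t₂) ∧
      (∫ z, Ψ t₂ z) - ∫ z, Ψ t₁ z = ∫ t in Set.Ioc t₁ t₂, ∫ z, Φ t z := by
  have hp := integrableOn_prod_of_bound hc hm hi hb hbound t₁ t₂
  refine ⟨hp.integral_prod_left, ?_⟩
  rw [← integral_sub (hiΨ t₂) (hiΨ t₁), integral_integral_swap hp]
  refine integral_congr_ae (Eventually.of_forall fun z => ?_)
  simp only
  rw [← intervalIntegral.integral_of_le h, intervalIntegral.integral_eq_sub_of_hasDerivAt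
    (fun t _ => hd z t) ((hc z).intervalIntegrable _ _)]

/-- The Sobolev regularity that the argument uses. -/
structure SobolevData (u ux uy uxy : ℝ → L2) : Prop where
  c : Continuous u
  cx : Continuous ux
  cy : Continuous uy
  cxy : Continuous uxy
  hx : ∀ t, HasWeakDeriv 1 0 (u t) (ux t)
  hy : ∀ t, HasWeakDeriv 0 1 (u t) (uy t)
  hxy : ∀ t, HasWeakDeriv 1 1 (u t) (uxy t)

variable {u ux uy uxy : ℝ → L2} {X X₁ X₂ X₃ : ℝ → ℝ}

theorem SobolevData.continuous_supBound (h : SobolevData u ux uy uxy) :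
    Continuous (fun t => supBound (u t) (ux t) (uy t) (uxy t)) := by
  have := h.c; have := h.cx; have := h.cy; have := h.cxy
  unfold supBound
  fun_prop

theorem supBound_nonneg (f fx fy fxy : L2) : 0 ≤ supBound f fx fy fxy := Real.sqrt_nonneg _

theorem SobolevData.memLp_sq (h : SobolevData u ux uy uxy) (t : ℝ) :
    MemLp (fun z => (u t z) ^ 2) 2 :=
  KP.memLp_sq (Lp.memLp (u t)) (ae_abs_le_supBound (h.hx t) (h.hy t) (h.hxy t))

/-- The integrand of the time derivative of the weighted mass of the mollified solution. -/
def virialDensity (u : ℝ → L2) (K : Cyl → ℝ) (c : ℝ) (X X₁ : ℝ → ℝ) (t : ℝ) (z : Cyl) : ℝ :=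
  2 * conv (dx K) (u t) z * (-(conv (dx^[4] K) (u t) z
    + 3 * conv (dx^[2] K) (fun z => (u t z) ^ 2) z + 3 * conv (dy^[2] K) (u t) z))
    * X (z.1 + -(c * t)) - c * conv (dx K) (u t) z ^ 2 * X₁ (z.1 + -(c * t))

theorem hasDerivAt_massDensity (h : SobolevData u ux uy uxy) (hs : SolvesKPII u) {K : Cyl → ℝ}
    (hK : IsTest K) (c : ℝ) (hX : Weight X X₁ X₂ X₃) (z : Cyl) (t : ℝ) :
    HasDerivAt (fun t => conv (dx K) (u t) z ^ 2 * X (z.1 + -(c * t)))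
      (virialDensity u K c X X₁ t z) t := by
  have h1 := (hs.hasDerivAt_conv h.c h.memLp_sq hK z).2 t
  have h2 : HasDerivAt (fun t : ℝ => z.1 + -(c * t)) (-c) t := by
    simpa using (((hasDerivAt_id t).const_mul c).neg).const_add z.1
  have h3 : HasDerivAt (fun t => X (z.1 + -(c * t))) (X₁ (z.1 + -(c * t)) * (-c)) t :=
    (hX.d₀ _).comp t h2
  have h4 := (h1.pow 2).mul h3
  refine h4.congr_deriv ?_
  simp only [virialDensity, Nat.cast_ofNat, Nat.add_one_sub_one, pow_one, Pi.pow_apply]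
  ring

theorem continuous_virialDensity (h : SobolevData u ux uy uxy) (hs : SolvesKPII u) {K : Cyl → ℝ}
    (hK : IsTest K) (c : ℝ) (hX : Weight X X₁ X₂ X₃) (z : Cyl) :
    Continuous (fun t => virialDensity u K c X X₁ t z) := by
  have h1 := hs.hasDerivAt_conv h.c h.memLp_sq hK z
  have c0 := continuous_of_hasDerivAt h1.2
  have c1 := continuous_of_hasDerivAt hX.d₀
  have c2 := continuous_of_hasDerivAt hX.d₁
  have hl : Continuous (fun t : ℝ => z.1 + -(c * t)) := by fun_prop
  exact (((continuous_const.mul c0).mul h1.1).mul (c1.comp hl)).sub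
    ((continuous_const.mul (c0.pow 2)).mul (c2.comp hl))

theorem integrable_virialDensity (h : SobolevData u ux uy uxy) {K : Cyl → ℝ}
    (hK : IsTest K) (c : ℝ) (hX : Weight X X₁ X₂ X₃) (t : ℝ) :
    Integrable (virialDensity u K c X X₁ t) :=
  integrable_virial c (conv_nice hK.dx (Lp.memLp (u t)))
    (conv_nice (hK.dx.dx.dx.dx) (Lp.memLp (u t))) (conv_nice hK.dx.dx (h.memLp_sq t))
    (conv_nice hK.dy.dy (Lp.memLp (u t))) (hX.translate (-(c * t)))

theorem stronglyMeasurable_virialDensity (h : SobolevData u ux uy uxy) {K : Cyl → ℝ}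
    (hK : IsTest K) (c : ℝ) (hX : Weight X X₁ X₂ X₃) (t : ℝ) :
    StronglyMeasurable (virialDensity u K c X X₁ t) := by
  have m := Lp.memLp (u t)
  have n1 := (conv_nice hK.dx m).cont
  have n2 := (conv_nice (hK.dx.dx.dx.dx) m).cont
  have n3 := (conv_nice hK.dx.dx (h.memLp_sq t)).cont
  have n4 := (conv_nice hK.dy.dy m).cont
  have c1 := (hX.translate (-(c * t))).bdd₀.cont
  have c2 := (hX.translate (-(c * t))).bdd₁.cont
  exact ((((continuous_const.mul n1).mul ((n2.add (continuous_const.mul n3)).add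
    (continuous_const.mul n4)).neg).mul c1).sub
    ((continuous_const.mul (n1.pow 2)).mul c2)).stronglyMeasurable

theorem exists_bound_virialDensity (h : SobolevData u ux uy uxy) {K : Cyl → ℝ}
    (hK : IsTest K) (c : ℝ) (hX : Weight X X₁ X₂ X₃) :
    ∃ b : ℝ → ℝ, Continuous b ∧ ∀ t, ∫ z, |virialDensity u K c X X₁ t z| ≤ b t := by
  obtain ⟨C, hC⟩ := hX.b₀
  obtain ⟨D, hD⟩ := hX.b₁
  have hC0 : 0 ≤ C := (abs_nonneg _).trans (hC 0)
  have hD0 : 0 ≤ D := (abs_nonneg _).trans (hD 0)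
  have tx4 : IsTest (dx^[4] K) := hK.dx.dx.dx.dx
  have tx2 : IsTest (dx^[2] K) := hK.dx.dx
  have ty2 : IsTest (dy^[2] K) := hK.dy.dy
  set a1 := ∫ z, |dx K z| with ha1
  set a2 := ∫ z, |(dx^[2] K) z| with ha2
  set a4 := ∫ z, |(dx^[4] K) z| with ha4
  set b2 := ∫ z, |(dy^[2] K) z| with hb2
  have pos : ∀ f : Cyl → ℝ, 0 ≤ ∫ z, |f z| := fun f => integral_nonneg fun _ => abs_nonneg _
  have cM := h.continuous_supBound
  have cu := h.c
  refine ⟨fun t => 2 * C * ((a1 * ‖u t‖) * (a4 * ‖u t‖ + 3 * (a2 *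
      (supBound (u t) (ux t) (uy t) (uxy t) * ‖u t‖)) + 3 * (b2 * ‖u t‖)))
      + |c| * D * (a1 * ‖u t‖) ^ 2, by fun_prop, fun t => ?_⟩
  have m := Lp.memLp (u t)
  have m2 := h.memLp_sq t
  have hsup := ae_abs_le_supBound (h.hx t) (h.hy t) (h.hxy t)
  set M := supBound (u t) (ux t) (uy t) (uxy t)
  have hM0 : 0 ≤ M := supBound_nonneg _ _ _ _
  have n1 := conv_nice hK.dx m
  have n4 := conv_nice tx4 m
  have n2 := conv_nice tx2 m2
  have ny := conv_nice ty2 m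
  have l1 : l2 (conv (dx K) (u t)) ≤ a1 * ‖u t‖ := by
    rw [← l2_eq_norm]; exact l2_conv_le hK.dx.continuous hK.dx.compact_support m
  have l4 : l2 (conv (dx^[4] K) (u t)) ≤ a4 * ‖u t‖ := by
    rw [← l2_eq_norm]; exact l2_conv_le tx4.continuous tx4.compact_support m
  have ly : l2 (conv (dy^[2] K) (u t)) ≤ b2 * ‖u t‖ := by
    rw [← l2_eq_norm]; exact l2_conv_le ty2.continuous ty2.compact_support m
  have lq : l2 (conv (dx^[2] K) (fun z => (u t z) ^ 2)) ≤ a2 * (M * ‖u t‖) := by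
    refine (l2_conv_le tx2.continuous tx2.compact_support m2).trans ?_
    refine mul_le_mul_of_nonneg_left ?_ (pos _)
    rw [← l2_eq_norm]
    exact l2_sq_le m hM0 hsup
  have n2' := n2.const_mul 3
  have ny' := ny.const_mul 3
  have cmul : ∀ f : Cyl → ℝ, MemLp f 2 → l2 (fun z => 3 * f z) ≤ 3 * l2 f := fun f hf =>
    l2_bdd_mul_le (f := fun _ => (3 : ℝ)) (by norm_num)
      (Eventually.of_forall fun _ => le_of_eq (abs_of_pos (by norm_num))) hf
  have lt := (l2_add_le (n4.add n2').memLp ny'.memLp).trans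
    (add_le_add_left (l2_add_le n4.memLp n2'.memLp) _)
  have lt' := cmul _ n2.memLp
  have lt'' := cmul _ ny.memLp
  have nt := (n4.add n2').add ny'
  have i1 := integral_abs_mul_le n1.memLp nt.memLp
  have i2 := integral_abs_mul_le n1.memLp n1.memLp
  have key : ∫ z, |virialDensity u K c X X₁ t z| ≤ ∫ z, (2 * C * |conv (dx K) (u t) z *
      (conv (dx^[4] K) (u t) z + 3 * conv (dx^[2] K) (fun z => (u t z) ^ 2) z
        + 3 * conv (dy^[2] K) (u t) z)| + |c| * D *
        |conv (dx K) (u t) z * conv (dx K) (u t) z|) := by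
    refine integral_mono (integrable_virialDensity h hK c hX t).abs
      (((n1.integrable_mul nt).abs.const_mul _).add ((n1.integrable_mul n1).abs.const_mul _))
      fun z => ?_
    simp only [virialDensity]
    refine (abs_sub _ _).trans (add_le_add ?_ ?_)
    · rw [abs_mul, abs_mul, abs_mul, abs_neg, abs_two, abs_mul]
      calc 2 * |conv (dx K) (u t) z| * |_| * |X (z.1 + -(c * t))| ≤
          2 * |conv (dx K) (u t) z| * |_| * C :=
            mul_le_mul_of_nonneg_left (hC _) (by positivity)
        _ = _ := by ring
    · rw [abs_mul, abs_mul, ← sq]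
      calc |c| * |conv (dx K) (u t) z ^ 2| * |X₁ (z.1 + -(c * t))| ≤
          |c| * |conv (dx K) (u t) z ^ 2| * D :=
            mul_le_mul_of_nonneg_left (hD _) (by positivity)
        _ = _ := by ring
  rw [integral_add ((n1.integrable_mul nt).abs.const_mul _)
    ((n1.integrable_mul n1).abs.const_mul _), integral_const_mul, integral_const_mul] at key
  have a1n : 0 ≤ a1 * ‖u t‖ := mul_nonneg (pos _) (norm_nonneg _)
  refine key.trans (add_le_add (mul_le_mul_of_nonneg_left (i1.trans ?_) (by positivity))
    (mul_le_mul_of_nonneg_left (i2.trans ?_) (by positivity)))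
  · exact mul_le_mul l1 (by linarith) (l2_nonneg _) a1n
  · rw [sq]
    exact mul_le_mul l1 l1 (l2_nonneg _) a1n

/-- The virial identity for the mollified solution. -/
theorem integral_virialDensity (h : SobolevData u ux uy uxy) {K : Cyl → ℝ}
    (hK : IsTest K) (c : ℝ) (hX : Weight X X₁ X₂ X₃) (t : ℝ) :
    ∫ z, virialDensity u K c X X₁ t z =
      virialMain c (fun x => X₁ (x + -(c * t))) (fun x => X₃ (x + -(c * t)))
        (conv (dx K) (u t)) (conv (dx (dx K)) (u t)) (conv (dy K) (u t))
      + 6 * ∫ z, (conv (dx (dx K)) (u t) z * X (z.1 + -(c * t))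
          + conv (dx K) (u t) z * X₁ (z.1 + -(c * t)))
          * (conv (dx K) (fun z => (u t z) ^ 2) z - conv (dx K) (u t) z ^ 2) := by
  have m := Lp.memLp (u t)
  have m2 := h.memLp_sq t
  have dv : HasDx (conv (dy K) (u t)) (conv (dy (dx K)) (u t)) := by
    rw [← hK.dx_dy_comm]; exact conv_hasDx hK.dy m
  exact virial_identity c (conv_nice hK.dx m) (conv_nice hK.dx.dx m) (conv_nice hK.dx.dx.dx m)
    (conv_nice hK.dx.dx.dx.dx m) (conv_nice hK.dx.dy m) (conv_nice hK.dy m)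
    (conv_nice hK.dy.dy m) (conv_nice hK.dx m2) (conv_nice hK.dx.dx m2)
    (conv_hasDx hK.dx m) (conv_hasDx hK.dx.dx m) (conv_hasDx hK.dx.dx.dx m)
    (conv_hasDy hK.dx m) dv (conv_hasDy hK.dy m) (conv_hasDx hK.dx m2)
    (hX.translate (-(c * t)))

/-- If the coercive part of the virial identity has a sign for all mollifications of a solution,
then the weighted mass of the solution is nonincreasing. -/
theorem antitone_of_virialMain_nonpos (h : SobolevData u ux uy uxy) (hs : SolvesKPII u) (c : ℝ)
    (hX : Weight X X₁ X₂ X₃)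
    (hmain : ∀ K : Cyl → ℝ, IsTest K → ∫ z, |dx K z| ≤ 2 → ∀ t,
      virialMain c (fun x => X₁ (x + -(c * t))) (fun x => X₃ (x + -(c * t)))
        (conv (dx K) (u t)) (conv (dx (dx K)) (u t)) (conv (dy K) (u t)) ≤ 0) :
    Antitone (fun t => ∫ z, (u t z) ^ 2 * X (z.1 + -(c * t))) := by
  obtain ⟨K, hK, hK2, hlim⟩ := exists_kernels
  obtain ⟨C₀, hC₀⟩ := hX.b₀
  obtain ⟨C₁, hC₁⟩ := hX.b₁
  set C := max C₀ C₁ with hCdef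
  have hX0 : ∀ x, |X x| ≤ C := fun x => (hC₀ x).trans (le_max_left _ _)
  have hX1 : ∀ x, |X₁ x| ≤ C := fun x => (hC₁ x).trans (le_max_right _ _)
  have hC : 0 ≤ C := (abs_nonneg _).trans (hX0 0)
  set M : ℝ → ℝ := fun t => supBound (u t) (ux t) (uy t) (uxy t) with hM
  have hM0 : ∀ t, 0 ≤ M t := fun t => supBound_nonneg _ _ _ _
  have hMc : Continuous M := h.continuous_supBound
  have m : ∀ t, MemLp (u t) 2 := fun t => Lp.memLp (u t)
  have hMu : ∀ t, ∀ᵐ z, |u t z| ≤ M t := fun t =>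
    ae_abs_le_supBound (h.hx t) (h.hy t) (h.hxy t)
  -- `p n t` bounds the `L²` distance between the mollified square and the square of the
  -- mollification.
  set p : ℕ → ℝ → ℝ := fun n t =>
    l2 (fun z => conv (dx (K n)) (fun z => (u t z) ^ 2) z - (u t z) ^ 2)
      + 2 * M t * l2 (fun z => conv (dx (K n)) (u t) z - u t z) with hp
  have hp0 : ∀ n t, 0 ≤ p n t := fun n t =>
    add_nonneg (l2_nonneg _) (mul_nonneg (mul_nonneg zero_le_two (hM0 t)) (l2_nonneg _))
  have hplim : ∀ t, Tendsto (fun n => p n t) atTop (𝓝 0) := by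
    intro t
    have := (hlim _ (h.memLp_sq t)).add ((hlim _ (m t)).const_mul (2 * M t))
    simpa using this
  -- Mollification has norm at most 2 on `L²`, so each difference costs a factor 3: 3M‖u‖ from the
  -- squares and 2M · 3‖u‖ from the second term.
  have hpb : ∀ n t, p n t ≤ 9 * M t * ‖u t‖ := by
    intro n t
    have s1 := l2_sub_le (conv_nice (hK n).dx (h.memLp_sq t)).memLp (h.memLp_sq t)
    have s2 := (hK n).dx.l2_conv_le_two (hK2 n) (h.memLp_sq t)
    have s3 := l2_sq_le (m t) (hM0 t) (hMu t)
    have s4 := l2_sub_le (conv_nice (hK n).dx (m t)).memLp (m t)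
    have s5 := (hK n).dx.l2_conv_le_two (hK2 n) (m t)
    rw [← l2_eq_norm]
    have s6 := mul_le_mul_of_nonneg_left (s4.trans (add_le_add_left s5 _))
      (mul_nonneg zero_le_two (hM0 t))
    simp only [hp]
    linarith
  set D : ℕ → ℝ → ℝ := fun n t => ∫ z, virialDensity u (K n) c X X₁ t z with hD
  have hDle : ∀ n t, D n t ≤ 6 * (C * (2 * ‖ux t‖ + 2 * ‖u t‖) * p n t) := by
    intro n t
    have e := integral_virialDensity h (hK n) c hX t
    have n1 := conv_nice (hK n).dx (m t)
    have n2 := conv_nice (hK n).dx.dx (m t)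
    have er := abs_virial_error_le n1 n2 (conv_nice (hK n).dx (h.memLp_sq t)).memLp hC
      (fun x => hX0 _) (fun x => hX1 _) (hX.translate (-(c * t)))
    have q1 := l2_conv_sq_sub_le (hK n).dx (m t) (hM0 t) (hMu t)
      (ae_abs_conv_le_supBound (hK n).dx (hK2 n) (h.hx t) (h.hy t) (h.hxy t))
    have q2 := l2_conv_dx_le (hK n).dx (hK2 n) (h.hx t)
    have q3 := (hK n).dx.l2_conv_le_two (hK2 n) (m t)
    rw [l2_eq_norm] at q3
    have er2 : C * (l2 (conv (dx (dx (K n))) (u t)) + l2 (conv (dx (K n)) (u t))) *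
        l2 (fun z => conv (dx (K n)) (fun z => (u t z) ^ 2) z - conv (dx (K n)) (u t) z ^ 2)
        ≤ C * (2 * ‖ux t‖ + 2 * ‖u t‖) * p n t :=
      mul_le_mul (mul_le_mul_of_nonneg_left (add_le_add q2 q3) hC) q1 (l2_nonneg _)
        (by positivity)
    have er3 := (le_abs_self _).trans (er.trans er2)
    have mn := hmain (K n) (hK n) (hK2 n) t
    simp only [hD]
    rw [e]
    linarith
  set w : ℕ → ℝ → Cyl → ℝ := fun n t => conv (dx (K n)) (u t) with hw
  set E : ℕ → ℝ → ℝ := fun n t => ∫ z, w n t z ^ 2 * X (z.1 + -(c * t)) with hE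
  have hElim : ∀ t, Tendsto (fun n => E n t) atTop
      (𝓝 (∫ z, (u t z) ^ 2 * X (z.1 + -(c * t)))) := by
    intro t
    rw [tendsto_iff_dist_tendsto_zero]
    have l0 : Tendsto (fun n => C * l2 (fun z => w n t z - u t z) * (3 * ‖u t‖)) atTop (𝓝 0) := by
      simpa using ((hlim _ (m t)).const_mul C).mul_const (3 * ‖u t‖)
    refine squeeze_zero (fun _ => dist_nonneg) (fun n => ?_) l0
    have n1 := conv_nice (hK n).dx (m t)
    have b := abs_integral_sq_sub_le n1.memLp (m t)
      (hX.translate (-(c * t))).bdd₀.cont.aestronglyMeasurable hC (fun z => hX0 _)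
    refine b.trans (mul_le_mul_of_nonneg_left ?_ (mul_nonneg hC (l2_nonneg _)))
    have := (hK n).dx.l2_conv_le_two (hK2 n) (m t)
    rw [l2_eq_norm] at this ⊢
    linarith
  intro t₁ t₂ h12
  have hFTC : ∀ n, IntegrableOn (D n) (Set.Ioc t₁ t₂) ∧
      E n t₂ - E n t₁ = ∫ t in Set.Ioc t₁ t₂, D n t := by
    intro n
    obtain ⟨b, hb, hbound⟩ := exists_bound_virialDensity h (hK n) c hX
    refine integral_sub_eq_integral_integral (hasDerivAt_massDensity h hs (hK n) c hX)
      (continuous_virialDensity h hs (hK n) c hX)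
      (stronglyMeasurable_virialDensity h (hK n) c hX) (fun t => ?_)
      (integrable_virialDensity h (hK n) c hX) hb hbound h12
    exact (integrable_sq (conv_nice (hK n).dx (m t)).memLp).mul_bdd
      (hX.translate (-(c * t))).bdd₀.cont.aestronglyMeasurable
      (Eventually.of_forall fun z => hX0 _)
  have hcux := h.cx
  have hcu := h.c
  -- `D n` is bounded only from above uniformly in `n`, so dominated convergence is applied to its
  -- positive part.
  have hdct : Tendsto (fun n => ∫ t in Set.Ioc t₁ t₂, max (D n t) 0) atTop
      (𝓝 (∫ t in Set.Ioc t₁ t₂, (0 : ℝ))) := by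
    have hbc : Continuous (fun t => 6 * (C * (2 * ‖ux t‖ + 2 * ‖u t‖) * (9 * M t * ‖u t‖))) := by
      fun_prop
    refine tendsto_integral_of_dominated_convergence
      (fun t => 6 * (C * (2 * ‖ux t‖ + 2 * ‖u t‖) * (9 * M t * ‖u t‖)))
      (fun n => ((hFTC n).1.1.sup aestronglyMeasurable_const))
      ((hbc.integrableOn_Icc (a := t₁) (b := t₂)).mono_set Set.Ioc_subset_Icc_self)
      (fun n => Eventually.of_forall fun t => ?_) (Eventually.of_forall fun t => ?_)
    · rw [Real.norm_eq_abs, abs_of_nonneg (le_max_right _ _)]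
      have hb := mul_le_mul_of_nonneg_left (hpb n t)
        (by positivity : 0 ≤ C * (2 * ‖ux t‖ + 2 * ‖u t‖))
      have hb0 := (mul_nonneg (by positivity : 0 ≤ C * (2 * ‖ux t‖ + 2 * ‖u t‖)) (hp0 n t))
      exact max_le (by linarith [hDle n t]) (by linarith)
    · have l0 : Tendsto (fun n => 6 * (C * (2 * ‖ux t‖ + 2 * ‖u t‖) * p n t)) atTop (𝓝 0) := by
        simpa using ((hplim t).const_mul (C * (2 * ‖ux t‖ + 2 * ‖u t‖))).const_mul 6
      refine squeeze_zero (fun _ => le_max_right _ _) (fun n => max_le (hDle n t) ?_) l0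
      exact mul_nonneg (by norm_num) (mul_nonneg (by positivity) (hp0 n t))
  rw [integral_zero] at hdct
  have hle : ∀ n, E n t₂ - E n t₁ ≤ ∫ t in Set.Ioc t₁ t₂, max (D n t) 0 := by
    intro n
    rw [(hFTC n).2]
    exact integral_mono (hFTC n).1 (hFTC n).1.pos_part fun t => le_max_left _ _
  have := le_of_tendsto_of_tendsto' ((hElim t₂).sub (hElim t₁)) hdct hle
  simp only
  linarith

end Monotonicity


/-! ### The weight `χ_ε` and its derivatives. -/

section Chi

theorem hasDerivAt_tanh (y : ℝ) : HasDerivAt Real.tanh (1 - Real.tanh y ^ 2) y := by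
  have hc := (Real.cosh_pos y).ne'
  have h := (Real.hasDerivAt_sinh y).div (Real.hasDerivAt_cosh y) hc
  have e : Real.tanh = fun y => Real.sinh y / Real.cosh y :=
    funext Real.tanh_eq_sinh_div_cosh
  rw [e]
  refine h.congr_deriv ?_
  field_simp

theorem tanh_sq_le_one (y : ℝ) : Real.tanh y ^ 2 ≤ 1 := by
  rw [Real.tanh_eq_sinh_div_cosh, div_pow, div_le_one (pow_pos (Real.cosh_pos y) 2)]
  linarith [Real.cosh_sq y]

theorem abs_tanh_le_one (y : ℝ) : |Real.tanh y| ≤ 1 :=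
  (sq_le_one_iff_abs_le_one _).1 (tanh_sq_le_one y)

theorem chi_nonneg (ε x : ℝ) : 0 ≤ chi ε x := by
  have := (abs_le.1 (abs_tanh_le_one (ε * x))).1
  simp only [chi]
  linarith

theorem chi_le_one (ε x : ℝ) : chi ε x ≤ 1 := by
  have := (abs_le.1 (abs_tanh_le_one (ε * x))).2
  simp only [chi]
  linarith

theorem chi_le_exp (ε x : ℝ) : chi ε x ≤ Real.exp (2 * (ε * x)) := by
  have h := Real.cosh_pos (ε * x)
  have e : chi ε x = Real.exp (ε * x) / (2 * Real.cosh (ε * x)) := by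
    rw [chi, Real.tanh_eq_sinh_div_cosh, ← Real.cosh_add_sinh (ε * x)]
    field_simp
  rw [e, div_le_iff₀ (by positivity), Real.cosh_eq, two_mul (ε * x), Real.exp_add, Real.exp_neg]
  have := Real.exp_pos (ε * x)
  have h2 : Real.exp (ε * x) * Real.exp (ε * x) *
      (2 * ((Real.exp (ε * x) + (Real.exp (ε * x))⁻¹) / 2)) =
      Real.exp (ε * x) + Real.exp (ε * x) ^ 3 := by
    field_simp
    ring
  rw [h2]
  linarith [pow_pos this 3]

/-- The derivative of `chi`. -/
def chi₁ (ε x : ℝ) : ℝ := ε / 2 * (1 - Real.tanh (ε * x) ^ 2)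

/-- The second derivative of `chi`. -/
def chi₂ (ε x : ℝ) : ℝ := -(2 * ε * Real.tanh (ε * x)) * chi₁ ε x

/-- The third derivative of `chi`. -/
def chi₃ (ε x : ℝ) : ℝ := ε ^ 2 * (6 * Real.tanh (ε * x) ^ 2 - 2) * chi₁ ε x

theorem hasDerivAt_tanh_mul (ε x : ℝ) :
    HasDerivAt (fun x => Real.tanh (ε * x)) (ε * (1 - Real.tanh (ε * x) ^ 2)) x := by
  have h := (hasDerivAt_tanh (ε * x)).comp x ((hasDerivAt_id x).const_mul ε)
  refine h.congr_deriv ?_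
  ring

theorem hasDerivAt_chi (ε x : ℝ) : HasDerivAt (chi ε) (chi₁ ε x) x := by
  refine (((hasDerivAt_tanh_mul ε x).const_add 1).div_const 2).congr_deriv ?_
  rw [chi₁]; ring

theorem hasDerivAt_chi₁ (ε x : ℝ) : HasDerivAt (chi₁ ε) (chi₂ ε x) x := by
  refine ((((hasDerivAt_tanh_mul ε x).pow 2).const_sub 1).const_mul (ε / 2)).congr_deriv ?_
  simp only [chi₁, chi₂, Nat.cast_ofNat, Nat.add_one_sub_one, pow_one]
  ring

theorem hasDerivAt_chi₂ (ε x : ℝ) : HasDerivAt (chi₂ ε) (chi₃ ε x) x := by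
  refine ((((hasDerivAt_tanh_mul ε x).const_mul (2 * ε)).neg).mul
    (hasDerivAt_chi₁ ε x)).congr_deriv ?_
  simp only [chi₁, chi₂, chi₃, Pi.neg_apply]
  ring

theorem chi₁_nonneg {ε : ℝ} (hε : 0 ≤ ε) (x : ℝ) : 0 ≤ chi₁ ε x :=
  mul_nonneg (by positivity) (sub_nonneg.2 (tanh_sq_le_one _))

theorem chi₁_le {ε : ℝ} (hε : 0 ≤ ε) (x : ℝ) : chi₁ ε x ≤ ε / 2 := by
  rw [chi₁]
  exact mul_le_of_le_one_right (by positivity) (by linarith [sq_nonneg (Real.tanh (ε * x))])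

theorem abs_chi₂_le {ε : ℝ} (hε : 0 ≤ ε) (hε2 : ε ≤ 1 / 2) (x : ℝ) : |chi₂ ε x| ≤ chi₁ ε x := by
  rw [chi₂, abs_mul, abs_of_nonneg (chi₁_nonneg hε x), abs_neg, abs_mul,
    abs_of_nonneg (by positivity : 0 ≤ 2 * ε)]
  refine mul_le_of_le_one_left (chi₁_nonneg hε x) ?_
  nlinarith [abs_tanh_le_one (ε * x), abs_nonneg (Real.tanh (ε * x))]

/-- As tanh² lies in [0, 1], |6 tanh² - 2| ≤ 4. -/
theorem abs_chi₃_le {ε : ℝ} (hε : 0 ≤ ε) (x : ℝ) : |chi₃ ε x| ≤ 4 * ε ^ 2 * chi₁ ε x := by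
  rw [chi₃, abs_mul, abs_of_nonneg (chi₁_nonneg hε x)]
  refine mul_le_mul_of_nonneg_right ?_ (chi₁_nonneg hε x)
  rw [abs_mul, abs_of_nonneg (sq_nonneg ε), mul_comm]
  refine mul_le_mul_of_nonneg_right ?_ (sq_nonneg ε)
  rw [abs_le]
  constructor <;> linarith [tanh_sq_le_one (ε * x), sq_nonneg (Real.tanh (ε * x))]

theorem continuous_tanh_mul (ε : ℝ) : Continuous (fun x => Real.tanh (ε * x)) :=
  continuous_of_hasDerivAt (hasDerivAt_tanh_mul ε)

theorem weight_chi {ε : ℝ} (hε : 0 ≤ ε) (hε2 : ε ≤ 1 / 2) :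
    Weight (chi ε) (chi₁ ε) (chi₂ ε) (chi₃ ε) where
  d₀ := hasDerivAt_chi ε
  d₁ := hasDerivAt_chi₁ ε
  d₂ := hasDerivAt_chi₂ ε
  b₀ := ⟨1, fun x => by rw [abs_of_nonneg (chi_nonneg ε x)]; exact chi_le_one ε x⟩
  b₁ := ⟨ε / 2, fun x => by rw [abs_of_nonneg (chi₁_nonneg hε x)]; exact chi₁_le hε x⟩
  b₂ := ⟨ε / 2, fun x => (abs_chi₂_le hε hε2 x).trans (chi₁_le hε x)⟩
  b₃ := ⟨4 * ε ^ 2 * (ε / 2), fun x => (abs_chi₃_le hε x).trans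
    (mul_le_mul_of_nonneg_left (chi₁_le hε x) (by positivity))⟩
  c₃ := by
    have h1 := continuous_of_hasDerivAt (hasDerivAt_chi₁ ε)
    have h2 := continuous_tanh_mul ε
    exact (continuous_const.mul ((continuous_const.mul (h2.pow 2)).sub continuous_const)).mul h1

theorem weight_const (a : ℝ) : Weight (fun _ => a) (fun _ => 0) (fun _ => 0) (fun _ => 0) where
  d₀ _ := hasDerivAt_const _ _
  d₁ _ := hasDerivAt_const _ _
  d₂ _ := hasDerivAt_const _ _
  b₀ := ⟨|a|, fun _ => le_rfl⟩
  b₁ := ⟨0, by simp⟩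
  b₂ := ⟨0, by simp⟩
  b₃ := ⟨0, by simp⟩
  c₃ := continuous_const

end Chi

/-! ### Conservation of mass, monotonicity for `χ_ε`, and decay at spatial infinity. -/

section Main

/-- Equal mollifications have equal limits. This transfers the continuity asserted for the weak
derivative of order (0,0) to `u` itself. -/
theorem eq_of_hasWeakDeriv_zero {f g : L2} (h : HasWeakDeriv 0 0 f g) : f = g := by
  obtain ⟨K, hK, -, hlim⟩ := exists_kernels
  have hf := hlim f (Lp.memLp f)
  have hg := hlim g (Lp.memLp g)
  have hle : ‖f - g‖ ≤ 0 := by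
    refine ge_of_tendsto' (by simpa using hf.add hg) fun n => ?_
    have e : conv (dx (K n)) f = conv (dx (K n)) g := by
      have := conv_iterate_of_hasWeakDeriv h (hK n).dx
      simpa only [Function.iterate_zero, id_eq] using this
    have mf := (conv_nice (hK n).dx (Lp.memLp f)).memLp.sub (Lp.memLp f)
    have mg := (conv_nice (hK n).dx (Lp.memLp g)).memLp.sub (Lp.memLp g)
    have h1 := l2_sub_le (f := fun z => conv (dx (K n)) g z - g z)
      (g := fun z => conv (dx (K n)) f z - f z) mg mf
    rw [← l2_sub_eq_norm]
    have e2 : (fun z => f z - g z) = fun z =>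
        (conv (dx (K n)) g z - g z) - (conv (dx (K n)) f z - f z) := by
      rw [e]; funext z; ring
    rw [e2]
    linarith
  exact sub_eq_zero.1 (norm_eq_zero.1 (le_antisymm hle (norm_nonneg _)))

theorem ContinuousInSobolev.exists_sobolevData {k : ℕ} (hk : 2 ≤ k) {u : ℝ → L2}
    (h : ContinuousInSobolev k u) : ∃ ux uy uxy, SobolevData u ux uy uxy := by
  obtain ⟨v, hv, hv0⟩ := h 0 0 (by omega)
  obtain ⟨ux, cx, hx⟩ := h 1 0 (by omega)
  obtain ⟨uy, cy, hy⟩ := h 0 1 (by omega)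
  obtain ⟨uxy, cxy, hxy⟩ := h 1 1 (by omega)
  have e : u = v := funext fun t => eq_of_hasWeakDeriv_zero (hv0 t)
  exact ⟨ux, uy, uxy, by rw [e]; exact hv, cx, cy, cxy, hx, hy, hxy⟩

variable {u ux uy uxy : ℝ → L2}

/-- Conservation of the `L²` norm. -/
theorem norm_eq_norm_zero (h : SobolevData u ux uy uxy) (hs : SolvesKPII u) (t : ℝ) :
    ‖u t‖ = ‖u 0‖ := by
  have key : ∀ a : ℝ, Antitone (fun t => ∫ z, (u t z) ^ 2 * a) := by
    intro a
    -- With a constant weight the main part vanishes whatever the sign of `a`. Taking a = 1 and a =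
    -- -1 gives both monotonicities.
    refine antitone_of_virialMain_nonpos h hs 0 (weight_const a) fun K _ _ t => ?_
    simp [virialMain]
  have e : ∀ s, ∫ z, (u s z) ^ 2 = ‖u s‖ ^ 2 := fun s => by
    rw [← l2_sq (Lp.memLp (u s)), l2_eq_norm]
  have key' : ∀ a : ℝ, Antitone (fun t => ‖u t‖ ^ 2 * a) := by
    intro a
    have := key a
    simpa only [integral_mul_const, e] using this
  have hsq : ∀ s r, s ≤ r → ‖u s‖ ^ 2 = ‖u r‖ ^ 2 := by
    intro s r hsr
    have h1 := key' 1 hsr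
    have h2 := key' (-1) hsr
    simp only at h1 h2
    linarith
  have : ‖u t‖ ^ 2 = ‖u 0‖ ^ 2 := by
    rcases le_total t 0 with ht | ht
    · exact hsq t 0 ht
    · exact (hsq 0 t ht).symm
  exact (sq_eq_sq₀ (norm_nonneg _) (norm_nonneg _)).1 this

/-- The constant 24 is 12 · 2: 12 from the cubic term, and 2 because the mollification has norm at
most 2‖u(t)‖ = 2‖u(0)‖ ≤ 2δ. -/
theorem antitone_weightedMass (h : SobolevData u ux uy uxy) (hs : SolvesKPII u) {c δ ε : ℝ}
    (hδ : ‖u 0‖ ≤ δ) (hε : 0 ≤ ε) (hε2 : ε ≤ 1 / 2) (h1 : 24 * δ + 4 * ε ^ 2 ≤ c)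
    (h2 : 24 * δ ≤ 3) (x₀ : ℝ) :
    Antitone (fun t => weightedMass ε (x₀ - c * t) (u t)) := by
  have hX := (weight_chi hε hε2).translate x₀
  have key := antitone_of_virialMain_nonpos h hs c hX fun K hK hK2 t => by
    have m := Lp.memLp (u t)
    have dv : HasDx (conv (dy K) (u t)) (conv (dy (dx K)) (u t)) := by
      rw [← hK.dx_dy_comm]; exact conv_hasDx hK.dy m
    have hw := hK.dx.l2_conv_le_two hK2 m
    rw [l2_eq_norm, norm_eq_norm_zero h hs t] at hw
    exact virialMain_nonpos (a := 4 * ε ^ 2) (η := 2 * δ) (conv_nice hK.dx m)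
      (conv_nice hK.dx.dx m) (conv_nice hK.dx.dy m) (conv_nice hK.dy m) (conv_hasDx hK.dx m)
      (conv_hasDy hK.dx m) dv (hX.translate (-(c * t))) (fun x => chi₁_nonneg hε _)
      (fun x => abs_chi₂_le hε hε2 _) (fun x => abs_chi₃_le hε _) (by linarith) (by linarith)
      (by linarith)
  have e : (fun t => weightedMass ε (x₀ - c * t) (u t)) =
      fun t => ∫ z, (u t z) ^ 2 * chi ε (z.1 + -(c * t) + x₀) := by
    funext t
    simp only [weightedMass]
    congr 1
    funext z
    congr 2
    ring
  rw [e]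
  exact key

theorem weightedMass_nonneg (ε a : ℝ) (f : L2) : 0 ≤ weightedMass ε a f :=
  integral_nonneg fun _ => mul_nonneg (sq_nonneg _) (chi_nonneg _ _)

theorem tendsto_weightedMass_atBot {ε : ℝ} (hε : 0 < ε) (f : L2) :
    Tendsto (fun a => weightedMass ε a f) atBot (𝓝 0) := by
  have hchi : Tendsto (chi ε) atBot (𝓝 0) := by
    have : Tendsto (fun x => Real.exp (2 * (ε * x))) atBot (𝓝 0) :=
      Real.tendsto_exp_atBot.comp
        ((tendsto_id.const_mul_atBot hε).const_mul_atBot two_pos)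
    exact squeeze_zero (chi_nonneg ε) (chi_le_exp ε) this
  have m := Lp.memLp f
  have hc : Continuous (chi ε) := continuous_of_hasDerivAt (hasDerivAt_chi ε)
  have h := tendsto_integral_filter_of_dominated_convergence (μ := (volume : Measure Cyl))
    (l := atBot) (F := fun a z => (f z) ^ 2 * chi ε (z.1 + a)) (f := fun _ => 0)
    (fun z => (f z) ^ 2)
    (Eventually.of_forall fun a => (integrable_sq m).1.mul
      (hc.comp (continuous_fst.add continuous_const)).aestronglyMeasurable)
    (Eventually.of_forall fun a => Eventually.of_forall fun z => by
      rw [Real.norm_eq_abs, abs_mul, abs_of_nonneg (sq_nonneg _),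
        abs_of_nonneg (chi_nonneg _ _)]
      exact mul_le_of_le_one_right (sq_nonneg _) (chi_le_one _ _))
    (integrable_sq m)
    (Eventually.of_forall fun z => by
      simpa using (hchi.comp (tendsto_atBot_add_const_left atBot z.1 tendsto_id)).const_mul
        ((f z) ^ 2))
  simpa [weightedMass] using h

end Main

end KP

end

theorem lemma5p3 (c₁ : ℝ) (hc₁ : 0 < c₁) :
    ∃ δ ε₀ : ℝ, 0 < δ ∧ 0 < ε₀ ∧
      ∀ u : ℝ → KP.L2, KP.ContinuousInSobolev 8 u → KP.SolvesKPII u → ‖u 0‖ ≤ δ →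
        ∀ ε : ℝ, 0 < ε → ε < ε₀ →
          (∀ x₀ : ℝ,
            Antitone (fun t : ℝ => KP.weightedMass ε (x₀ - c₁ * t) (u t)) ∧
            (∀ᵐ t : ℝ, DifferentiableAt ℝ
              (fun t : ℝ => KP.weightedMass ε (x₀ - c₁ * t) (u t)) t) ∧
            (∀ t d : ℝ,
              HasDerivAt (fun t : ℝ => KP.weightedMass ε (x₀ - c₁ * t) (u t)) d t → d ≤ 0)) ∧
          Tendsto (fun t : ℝ => KP.weightedMass ε (-(c₁ * t)) (u t)) atTop (𝓝 0) := by
  -- These give 24δ ≤ 3, 24δ ≤ c₁/4 and 4ε² ≤ c₁/4, so monotonicity holds already at speed c₁/2; ε ≤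
  -- 1/2 ensures |χ''| ≤ χ'.
  refine ⟨min (1 / 8) (c₁ / 96), min (1 / 2) (Real.sqrt c₁ / 4), by positivity, by positivity, ?_⟩
  intro u hu hs hδ ε hε hε₀
  obtain ⟨ux, uy, uxy, h⟩ := hu.exists_sobolevData (by norm_num)
  have d1 := min_le_left (1 / 8 : ℝ) (c₁ / 96)
  have d2 := min_le_right (1 / 8 : ℝ) (c₁ / 96)
  have e1 : ε ≤ 1 / 2 := hε₀.le.trans (min_le_left _ _)
  have e2 : ε ≤ Real.sqrt c₁ / 4 := hε₀.le.trans (min_le_right _ _)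
  have e3 : 4 * ε ^ 2 ≤ c₁ / 4 := by
    have := pow_le_pow_left₀ hε.le e2 2
    rw [div_pow, Real.sq_sqrt hc₁.le] at this
    linarith
  have anti : ∀ x₀ : ℝ, Antitone (fun t : ℝ => KP.weightedMass ε (x₀ - c₁ * t) (u t)) :=
    KP.antitone_weightedMass h hs hδ hε.le e1 (by linarith) (by linarith)
  have anti' : ∀ x₀ : ℝ, Antitone (fun t : ℝ => KP.weightedMass ε (x₀ - c₁ / 2 * t) (u t)) :=
    KP.antitone_weightedMass h hs hδ hε.le e1 (by linarith) (by linarith)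
  refine ⟨fun x₀ => ⟨anti x₀, ?_, fun t d hd => ?_⟩, ?_⟩
  · filter_upwards [(anti x₀).neg.ae_differentiableAt] with t ht
    simpa using ht.neg
  · rw [← hd.deriv]
    exact (anti x₀).deriv_nonpos
  · have hlim : Tendsto (fun t : ℝ => KP.weightedMass ε (-(c₁ / 2 * t)) (u 0)) atTop (𝓝 0) :=
      (KP.tendsto_weightedMass_atBot hε (u 0)).comp
        (tendsto_neg_atTop_atBot.comp (tendsto_id.const_mul_atTop (by positivity)))
    refine squeeze_zero' (Eventually.of_forall fun t => KP.weightedMass_nonneg _ _ _) ?_ hlim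
    filter_upwards [eventually_ge_atTop (0 : ℝ)] with t ht
    -- The shift depends on the final time: between times 0 and `t` the weight moves from offset
    -- -c₁t/2 to offset -c₁t.
    have := anti' (-(c₁ / 2 * t)) ht
    simp only [mul_zero, sub_zero] at this
    rwa [show -(c₁ / 2 * t) - c₁ / 2 * t = -(c₁ * t) by ring] at this
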